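/- Let $k$ be a field of characteristic zero and let $\mathfrak g=\mathfrak g_{\bar 0}\oplus\mathfrak g_{\bar 1}$ be a finite-dimensional Lie superalgebra over $k$ with universal enveloping superalgebra $\mathcal U\mathfrak g$. Let $\phi$ be a (parity preserving) automorphism of $\mathfrak g$ that fixes $\mathfrak g_{\bar 0}$ pointwise, and suppose that $\phi(u)=u$ implies $u\in\mathfrak g_{\bar 0}$. Let $\mathfrak g$ act on $\mathcal U\mathfrak g$ by the $\phi$-twisted adjoint action, given on homogeneous elements by $$\operatorname{ad}_\phi(u)(v)=uv-(-1)^{\bar u\bar v}\,v\,\phi(u)\qquad(u\in\mathfrak g,\ v\in\mathcal U\mathfrak g),$$ extend it to a representation $\operatorname{ad}_\phi$ of the algebra $\mathcal U\mathfrak g$ on $\mathcal U\mathfrak g$, and let $\mathcal A_\phi=\{v\in\mathcal U\mathfrak g:\operatorname{ad}_\phi(u)(v)=0\text{ for all }u\in\mathfrak g\}$. (1) Let $\mathfrak g_{\bar 0}$ act on $\mathcal U\mathfrak g_{\bar 0}$ by the adjoint action. Then there is a parity preserving isomorphism of $\mathfrak g$-modules $$\operatorname{Ind}_{\mathfrak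 g_{\bar 0}}^{\mathfrak g}\mathcal U\mathfrak g_{\bar 0}=\mathcal U\mathfrak g\otimes_{\mathcal U\mathfrak g_{\bar 0}}\mathcal U\mathfrak g_{\bar 0}\;\xrightarrow{\ \sim\ }\;(\mathcal U\mathfrak g,\operatorname{ad}_\phi)$$ which sends $1\otimes w$ to $w$ for all $w\in\mathcal U\mathfrak g_{\bar 0}$. (2) Suppose that $\operatorname{Ber}(\mathfrak g_{\bar 1})$ is a trivial $\mathfrak g_{\bar 0}$-module (up to parity), i.e. $\operatorname{tr}(\operatorname{ad}x|_{\mathfrak g_{\bar 1}})=0$ for all $x\in\mathfrak g_{\bar 0}$. Then the space $(\mathcal U\mathfrak g/\mathcal U\mathfrak g\,\mathfrak g_{\bar 0})^{\mathfrak g}$ of invariants for left multiplication is one-dimensional, and for every $v_{\mathfrak g}\in\mathcal U\mathfrak g$ that represents a nonzero element of it, the map $$z\mapsto\operatorname{ad}_\phi(v_{\mathfrak g})(z)$$ is an isomorphism of vector spaces from the centre $\mathcal Z(\mathcal U\mathfrak g_{\bar 0})$ of $\mathcal U\mathfrak g_{\bar 0}$ onto $\mathcal A_\phi$. -/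

import Mathlib

/-- The Koszul sign `(-1)^{ij}` of two parities. -/
def koszulSign (i j : ZMod 2) : ℤ := (-1) ^ (i.val * j.val)

/-- A Lie superalgebra over a field `k`: a vector space `g = g₀ ⊕ g₁` with an even bilinear bracket
which is super skew-symmetric and satisfies the super Jacobi identity. -/
class LieSuperalgebra (k g : Type*) [Field k] [AddCommGroup g] [Module k g] where
  /-- The homogeneous parts `g₀` (even) and `g₁` (odd). -/
  part : ZMod 2 → Submodule k g
  isCompl_part : IsCompl (part 0) (part 1)
  /-- The superbracket. -/
  bracket : g →ₗ[k] g →ₗ[k] g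
  bracket_mem : ∀ {i j : ZMod 2} {x y : g}, x ∈ part i → y ∈ part j → bracket x y ∈ part (i + j)
  bracket_skew : ∀ {i j : ZMod 2} {x y : g}, x ∈ part i → y ∈ part j →
    bracket x y = -(koszulSign i j • bracket y x)
  bracket_jacobi : ∀ {i j : ZMod 2} {x y : g} (z : g), x ∈ part i → y ∈ part j →
    bracket x (bracket y z) = bracket (bracket x y) z + koszulSign i j • bracket y (bracket x z)

namespace LieSuperalgebra

section Basic

variable (k g : Type*) [Field k] [AddCommGroup g] [Module k g] [LieSuperalgebra k g]

/-- The even part `g₀`. -/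
abbrev even : Submodule k g := part 0

/-- The odd part `g₁`. -/
abbrev odd : Submodule k g := part 1

/-- The projection `g → g₀ ⊆ g` along `g₁`. -/
noncomputable def evenProj : g →ₗ[k] g := (even k g).projection (odd k g) isCompl_part

/-- The projection `g → g₁ ⊆ g` along `g₀`. -/
noncomputable def oddProj : g →ₗ[k] g := (odd k g).projection (even k g) isCompl_part.symm

variable {k g}

theorem evenProj_of_even {x : g} (hx : x ∈ even k g) : evenProj k g x = x :=
  Submodule.projection_apply_of_mem_left _ hx

theorem evenProj_of_odd {x : g} (hx : x ∈ odd k g) : evenProj k g x = 0 :=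
  (Submodule.projection_apply_eq_zero_iff _).2 hx

theorem oddProj_of_even {x : g} (hx : x ∈ even k g) : oddProj k g x = 0 :=
  (Submodule.projection_apply_eq_zero_iff _).2 hx

theorem oddProj_of_odd {x : g} (hx : x ∈ odd k g) : oddProj k g x = x :=
  Submodule.projection_apply_of_mem_left _ hx

theorem zmod_two_cases (i : ZMod 2) : i = 0 ∨ i = 1 := by
  revert i; decide

theorem koszulSign_zero_left (j : ZMod 2) : koszulSign 0 j = 1 := by
  simp [koszulSign]

theorem koszulSign_zero_right (j : ZMod 2) : koszulSign j 0 = 1 := by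
  simp [koszulSign]

theorem koszulSign_one_one : koszulSign 1 1 = -1 := by decide

/-- The even part is closed under the bracket. -/
instance : Bracket (even k g) (even k g) where
  bracket x y := ⟨bracket (k := k) (x : g) (y : g), by simpa using bracket_mem x.2 y.2⟩

theorem coe_even_bracket (x y : even k g) :
    ((⁅x, y⁆ : even k g) : g) = bracket (k := k) (x : g) (y : g) := rfl

/-- The even part of a Lie superalgebra is a Lie algebra. -/
instance [CharZero k] : LieRing (even k g) where
  add_lie x y z := Subtype.ext (by simp [coe_even_bracket])
  lie_add x y z := Subtype.ext (by simp [coe_even_bracket])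
  lie_self x := Subtype.ext (by
    have h := bracket_skew (k := k) x.2 x.2
    rw [koszulSign_zero_left, one_smul, eq_neg_iff_add_eq_zero, ← two_smul k] at h
    simpa [coe_even_bracket] using h)
  leibniz_lie x y z := Subtype.ext (by
    have h := bracket_jacobi (k := k) (z : g) x.2 y.2
    rw [koszulSign_zero_left, one_smul] at h
    simpa [coe_even_bracket] using h)

instance [CharZero k] : LieAlgebra k (even k g) where
  lie_smul t x y := Subtype.ext (by simp [coe_even_bracket])

/-- The adjoint action of an even element on the odd part. -/
noncomputable def adOdd (x : even k g) : odd k g →ₗ[k] odd k g :=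
  (bracket (k := k) (x : g)).restrict (fun y hy => by simpa using bracket_mem x.2 hy)

variable (k g)

/-- The character of `g₀` on the one-dimensional module `Ber(g₁)`. For a super vector space `V` with
an action of `g₀` it is `tr_{V₀} - tr_{V₁}`; here `V = g₁` is purely odd. -/
noncomputable def berOdd (x : even k g) : k := -LinearMap.trace k (odd k g) (adOdd x)

/-- The `g₀`-module `Ber(g₁)` is trivial, up to parity. -/
def BerOddTrivial : Prop := ∀ x : even k g, berOdd k g x = 0

/-- An automorphism of a Lie superalgebra: a parity preserving linear bijection which respects the
bracket. -/
structure Aut extends g ≃ₗ[k] g where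
  map_part : ∀ {i : ZMod 2} {x : g}, x ∈ part (k := k) i → toFun x ∈ part (k := k) i
  map_bracket : ∀ x y : g, toFun (bracket (k := k) x y) = bracket (k := k) (toFun x) (toFun y)

instance : CoeFun (Aut k g) (fun _ => g → g) := ⟨fun φ => φ.toLinearEquiv⟩

end Basic

section Enveloping

variable (k g : Type*) [Field k] [AddCommGroup g] [Module k g] [LieSuperalgebra k g]

/-- The relations `x y = (-1)^{|x||y|} y x + [x, y]`, for homogeneous `x` and `y`. -/
inductive EnvRel : TensorAlgebra k g → TensorAlgebra k g → Prop
  | mk {i j : ZMod 2} {x y : g} (hx : x ∈ part (k := k) i) (hy : y ∈ part (k := k) j) :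
      EnvRel (TensorAlgebra.ι k x * TensorAlgebra.ι k y)
        (koszulSign i j • (TensorAlgebra.ι k y * TensorAlgebra.ι k x) +
          TensorAlgebra.ι k (bracket (k := k) x y))

/-- The universal enveloping superalgebra `Ug`. -/
def Env : Type _ := RingQuot (EnvRel k g)

namespace Env

noncomputable instance : Ring (Env k g) := inferInstanceAs (Ring (RingQuot (EnvRel k g)))

noncomputable instance : Algebra k (Env k g) :=
  inferInstanceAs (Algebra k (RingQuot (EnvRel k g)))

/-- The canonical map `g → Ug`. -/
noncomputable def ι : g →ₗ[k] Env k g :=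
  (RingQuot.mkAlgHom k (EnvRel k g)).toLinearMap ∘ₗ TensorAlgebra.ι k

variable {k g}

theorem ι_mul_ι {i j : ZMod 2} {x y : g} (hx : x ∈ part (k := k) i) (hy : y ∈ part (k := k) j) :
    ι k g x * ι k g y =
      koszulSign i j • (ι k g y * ι k g x) + ι k g (bracket (k := k) x y) := by
  have h := RingQuot.mkAlgHom_rel k (EnvRel.mk hx hy)
  rw [map_mul, map_add, map_zsmul, map_mul] at h
  exact h

variable {A : Type*} [Ring A] [Algebra k A]

/-- The universal property of `Ug`. -/
noncomputable def lift (f : g →ₗ[k] A)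
    (hf : ∀ (i j : ZMod 2) (x y : g), x ∈ part (k := k) i → y ∈ part (k := k) j →
      f x * f y = koszulSign i j • (f y * f x) + f (bracket (k := k) x y)) :
    Env k g →ₐ[k] A :=
  RingQuot.liftAlgHom k ⟨TensorAlgebra.lift k f, by
    rintro _ _ ⟨hx, hy⟩
    rw [map_mul, map_add, map_zsmul, map_mul]
    simpa using hf _ _ _ _ hx hy⟩

theorem lift_ι (f : g →ₗ[k] A)
    (hf : ∀ (i j : ZMod 2) (x y : g), x ∈ part (k := k) i → y ∈ part (k := k) j →
      f x * f y = koszulSign i j • (f y * f x) + f (bracket (k := k) x y)) (x : g) :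
    lift f hf (ι k g x) = f x := by
  have h := RingQuot.liftAlgHom_mkAlgHom_apply (S := k) (TensorAlgebra.lift k f) (by
    rintro _ _ ⟨hx, hy⟩
    rw [map_mul, map_add, map_zsmul, map_mul]
    simpa using hf _ _ _ _ hx hy : ∀ ⦃x y⦄, EnvRel k g x y →
      TensorAlgebra.lift k f x = TensorAlgebra.lift k f y) (TensorAlgebra.ι k x)
  rw [TensorAlgebra.lift_ι_apply] at h
  exact h

/-- `IsMonomial i a`: `a` is a product of homogeneous elements of `g` whose parities add up
to `i`. -/
inductive IsMonomial : ZMod 2 → Env k g → Prop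
  | one : IsMonomial 0 1
  | mul {i j : ZMod 2} {x : g} {a : Env k g} (hx : x ∈ LieSuperalgebra.part (k := k) i)
      (ha : IsMonomial j a) : IsMonomial (i + j) (ι k g x * a)

variable (k g)

/-- The homogeneous parts of `Ug`. -/
noncomputable def part (i : ZMod 2) : Submodule k (Env k g) := Submodule.span k {a | IsMonomial i a}

/-- The grading automorphism `a ↦ (-1)^{|a|} a` of `Ug`. -/
noncomputable def parity : Env k g →ₐ[k] Env k g :=
  lift (ι k g ∘ₗ (evenProj k g - oddProj k g)) (by
    intro i j x y hx hy
    have hb := bracket_mem (k := k) hx hy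
    have h := ι_mul_ι hx hy
    rcases zmod_two_cases i with rfl | rfl <;> rcases zmod_two_cases j with rfl | rfl
    · simp only [add_zero] at hb
      simpa [evenProj_of_even, oddProj_of_even, hx, hy, hb] using h
    · simp only [zero_add] at hb
      simp only [LinearMap.comp_apply, LinearMap.sub_apply, evenProj_of_even hx, oddProj_of_even hx,
        evenProj_of_odd hy, oddProj_of_odd hy, evenProj_of_odd hb, oddProj_of_odd hb, sub_zero,
        zero_sub, map_neg, mul_neg, neg_mul, h, smul_neg, neg_add]
    · simp only [add_zero] at hb
      simp only [LinearMap.comp_apply, LinearMap.sub_apply, evenProj_of_even hy, oddProj_of_even hy,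
        evenProj_of_odd hx, oddProj_of_odd hx, evenProj_of_odd hb, oddProj_of_odd hb, sub_zero,
        zero_sub, map_neg, mul_neg, neg_mul, h, smul_neg, neg_add]
    · have hb' : bracket (k := k) x y ∈ even k g := hb
      simp only [LinearMap.comp_apply, LinearMap.sub_apply, evenProj_of_odd hy, oddProj_of_odd hy,
        evenProj_of_odd hx, oddProj_of_odd hx, evenProj_of_even hb', oddProj_of_even hb', sub_zero,
        zero_sub, map_neg, mul_neg, neg_mul, h, neg_neg])

variable {k g}

theorem parity_ι_even {x : g} (hx : x ∈ even k g) : parity k g (ι k g x) = ι k g x := by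
  rw [parity, lift_ι]; simp [evenProj_of_even hx, oddProj_of_even hx]

theorem parity_ι_odd {x : g} (hx : x ∈ odd k g) : parity k g (ι k g x) = -ι k g x := by
  rw [parity, lift_ι]; simp [evenProj_of_odd hx, oddProj_of_odd hx]

/-- `parity` acts on the part of degree `i` by the sign `(-1)^i`. -/
theorem parity_of_mem {i : ZMod 2} {a : Env k g} (ha : a ∈ part k g i) :
    parity k g a = koszulSign 1 i • a := by
  induction ha using Submodule.span_induction with
  | zero => simp
  | add a b _ _ ha hb => simp [ha, hb]
  | smul c a _ ha => rw [map_smul, ha, smul_comm]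
  | mem a ha =>
    induction ha with
    | one => simp [koszulSign_zero_right]
    | @mul i j x a hx _ ih =>
      rw [map_mul, ih]
      rcases zmod_two_cases i with rfl | rfl
      · rw [parity_ι_even hx, zero_add, mul_smul_comm]
      · rw [parity_ι_odd hx]
        rcases zmod_two_cases j with rfl | rfl
        · simp [koszulSign_zero_right, koszulSign_one_one]
        · rw [show (1 + 1 : ZMod 2) = 0 from rfl]
          simp [koszulSign_zero_right, koszulSign_one_one]

theorem parity_parity (a : Env k g) : parity k g (parity k g a) = a := by
  have h : ((parity k g).comp (parity k g)) = AlgHom.id k (Env k g) := by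
    apply RingQuot.ringQuot_ext'
    ext x
    change parity k g (parity k g (ι k g x)) = ι k g x
    have hx : evenProj k g x + oddProj k g x = x :=
      Submodule.projection_add_projection_eq_self _ x
    have h0 : evenProj k g x ∈ even k g := Submodule.projection_apply_mem _ _
    have h1 : oddProj k g x ∈ odd k g := Submodule.projection_apply_mem _ _
    rw [← hx]
    simp [parity_ι_even h0, parity_ι_odd h1]
  exact DFunLike.congr_fun h a

end Env

end Enveloping

section Twisted

variable {k g : Type*} [Field k] [AddCommGroup g] [Module k g] [LieSuperalgebra k g]

open Env

/-- The `φ`-twisted adjoint action of `g` on `Ug`, on homogeneous elements given by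
`ad_φ(u)(v) = u v - (-1)^{|u||v|} v φ(u)`; see `adTwist_apply`. -/
noncomputable def adTwist (φ : Aut k g) : g →ₗ[k] Module.End k (Env k g) :=
  LinearMap.mk₂ k
    (fun u v => ι k g u * v - v * ι k g (φ (evenProj k g u)) -
      parity k g v * ι k g (φ (oddProj k g u)))
    (fun u u' v => by simp only [map_add, add_mul, mul_add]; abel)
    (fun c u v => by simp only [map_smul, smul_mul_assoc, mul_smul_comm, smul_sub])
    (fun u v v' => by simp only [map_add, add_mul, mul_add]; abel)
    (fun c u v => by simp only [map_smul, smul_mul_assoc, mul_smul_comm, smul_sub])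

theorem adTwist_even (φ : Aut k g) {u : g} (hu : u ∈ even k g) (v : Env k g) :
    adTwist φ u v = ι k g u * v - v * ι k g (φ u) := by
  simp [adTwist, evenProj_of_even hu, oddProj_of_even hu]

theorem adTwist_odd (φ : Aut k g) {u : g} (hu : u ∈ odd k g) (v : Env k g) :
    adTwist φ u v = ι k g u * v - parity k g v * ι k g (φ u) := by
  simp [adTwist, evenProj_of_odd hu, oddProj_of_odd hu]

/-- The defining formula of the twisted adjoint action. -/
theorem adTwist_apply (φ : Aut k g) {i j : ZMod 2} {u : g} {v : Env k g}
    (hu : u ∈ LieSuperalgebra.part (k := k) i) (hv : v ∈ Env.part k g j) :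
    adTwist φ u v = ι k g u * v - koszulSign i j • (v * ι k g (φ u)) := by
  rcases zmod_two_cases i with rfl | rfl
  · rw [adTwist_even φ hu, koszulSign_zero_left, one_smul]
  · rw [adTwist_odd φ hu, parity_of_mem hv, smul_mul_assoc]

/-- The `φ`-twisted adjoint action, extended to a representation of the algebra `Ug` on `Ug`. -/
noncomputable def adTwistRep (φ : Aut k g) : Env k g →ₐ[k] Module.End k (Env k g) :=
  Env.lift (adTwist φ) (by
    intro i j x y hx hy
    ext v
    have hb := bracket_mem (k := k) hx hy
    have hm : φ (bracket (k := k) x y) = bracket (k := k) (φ x) (φ y) := φ.map_bracket x y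
    have hφx : φ x ∈ LieSuperalgebra.part (k := k) i := φ.map_part hx
    have hφy : φ y ∈ LieSuperalgebra.part (k := k) j := φ.map_part hy
    have h := eq_sub_of_add_eq' (ι_mul_ι hx hy).symm
    have h' := eq_sub_of_add_eq' (ι_mul_ι hφx hφy).symm
    simp only [Module.End.mul_apply, LinearMap.add_apply, LinearMap.smul_apply]
    rcases zmod_two_cases i with rfl | rfl <;> rcases zmod_two_cases j with rfl | rfl
    · simp only [add_zero] at hb
      simp only [koszulSign_zero_left, one_smul] at h h' ⊢
      rw [adTwist_even φ hb, hm, h, h']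
      simp only [adTwist_even φ hx, adTwist_even φ hy]
      noncomm_ring
    · simp only [zero_add] at hb
      simp only [koszulSign_zero_left, one_smul] at h h' ⊢
      rw [adTwist_odd φ hb, hm, h, h']
      simp only [adTwist_even φ hx, adTwist_odd φ hy, map_sub, map_mul, parity_ι_even hx,
        parity_ι_even hφx]
      noncomm_ring
    · simp only [add_zero] at hb
      simp only [koszulSign_zero_right, one_smul] at h h' ⊢
      rw [adTwist_odd φ hb, hm, h, h']
      simp only [adTwist_odd φ hx, adTwist_even φ hy, map_sub, map_mul, parity_ι_even hy,
        parity_ι_even hφy]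
      noncomm_ring
    · have hb' : bracket (k := k) x y ∈ even k g := hb
      simp only [koszulSign_one_one, neg_smul, one_smul] at h h' ⊢
      rw [adTwist_even φ hb', hm, h, h']
      simp only [adTwist_odd φ hx, adTwist_odd φ hy, map_sub, map_mul, parity_ι_odd hx,
        parity_ι_odd hy, parity_ι_odd hφx, parity_ι_odd hφy, parity_parity]
      noncomm_ring)

theorem adTwistRep_ι (φ : Aut k g) (u : g) : adTwistRep φ (ι k g u) = adTwist φ u :=
  Env.lift_ι _ _ u

/-- The space `A_φ` of invariants of the `φ`-twisted adjoint action on `Ug`. -/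
noncomputable def twistInvariants (φ : Aut k g) : Submodule k (Env k g) :=
  ⨅ u : g, LinearMap.ker (adTwist φ u)

theorem mem_twistInvariants (φ : Aut k g) (v : Env k g) :
    v ∈ twistInvariants φ ↔ ∀ u : g, adTwist φ u v = 0 := by
  simp [twistInvariants]

end Twisted

section Induced

variable (k g : Type*) [Field k] [CharZero k] [AddCommGroup g] [Module k g] [LieSuperalgebra k g]

open Env

attribute [local instance] LieRing.ofAssociativeRing

/-- The canonical algebra map `Ug₀ → Ug`. -/
noncomputable def evenIncl : UniversalEnvelopingAlgebra k (even k g) →ₐ[k] Env k g :=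
  UniversalEnvelopingAlgebra.lift k
    { toLinearMap := ι k g ∘ₗ (even k g).subtype
      map_lie' := by
        intro x y
        have h := ι_mul_ι x.2 y.2
        rw [koszulSign_zero_left, one_smul] at h
        simp [LieRing.of_associative_ring_bracket, coe_even_bracket, h] }

/-- The adjoint representation of `g₀` on `Ug₀`, `x ↦ (w ↦ x w - w x)`, extended to the algebra
`Ug₀`. -/
noncomputable def evenAdRep : UniversalEnvelopingAlgebra k (even k g) →ₐ[k]
    Module.End k (UniversalEnvelopingAlgebra k (even k g)) :=
  UniversalEnvelopingAlgebra.lift k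
    ((LieAlgebra.ad k (UniversalEnvelopingAlgebra k (even k g))).comp
      (UniversalEnvelopingAlgebra.ι k))

variable {k}
variable {V : Type*} [AddCommGroup V] [Module k V]

open scoped TensorProduct

/-- The relations `(a w) ⊗ v = a ⊗ (w v)` with `a ∈ Ug`, `w ∈ Ug₀`, `v ∈ V`, which cut
`Ug ⊗ V` (over `Ug₀`) out of `Ug ⊗ V` (over `k`). -/
noncomputable def indRel (ρ : UniversalEnvelopingAlgebra k (even k g) →ₐ[k] Module.End k V) :
    Submodule (Env k g) (Env k g ⊗[k] V) :=
  Submodule.span (Env k g)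
    {t | ∃ (a : Env k g) (w : UniversalEnvelopingAlgebra k (even k g)) (v : V),
      t = (a * evenIncl k g w) ⊗ₜ[k] v - a ⊗ₜ[k] (ρ w v)}

/-- The induced module `Ind_{g₀}^{g} V`, the tensor product of the right `Ug₀`-module `Ug` with the
left `Ug₀`-module `V`, as a left `Ug`-module. -/
abbrev Ind (ρ : UniversalEnvelopingAlgebra k (even k g) →ₐ[k] Module.End k V) : Type _ :=
  (Env k g ⊗[k] V) ⧸ indRel g ρ

variable {g}

/-- The element `a ⊗ v` of `Ind_{g₀}^{g} V`. -/
noncomputable def Ind.tmul (ρ : UniversalEnvelopingAlgebra k (even k g) →ₐ[k] Module.End k V) (a : Env k g)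
    (v : V) : Ind g ρ := (indRel g ρ).mkQ (a ⊗ₜ[k] v)

/-- The homogeneous parts of `Ind_{g₀}^{g} V` for a purely even `V`. -/
noncomputable def Ind.part (ρ : UniversalEnvelopingAlgebra k (even k g) →ₐ[k] Module.End k V) (i : ZMod 2) :
    Submodule k (Ind g ρ) :=
  Submodule.span k {t | ∃ a ∈ Env.part k g i, ∃ v : V, t = Ind.tmul ρ a v}

end Induced

section GhostElement

variable (k g : Type*) [Field k] [AddCommGroup g] [Module k g] [LieSuperalgebra k g]

open Env

/-- The left ideal `Ug g₀` of `Ug`. -/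
noncomputable def evenLeftIdeal : Submodule (Env k g) (Env k g) :=
  Submodule.span (Env k g) (ι k g '' (even k g : Set g))

/-- The space `(Ug / Ug g₀)^g` of `g`-invariants for the action by left multiplication. -/
noncomputable def ghostInvariants : Submodule k (Env k g ⧸ evenLeftIdeal k g) :=
  ⨅ u : g, LinearMap.ker (Module.toModuleEnd k (S := Env k g) (Env k g ⧸ evenLeftIdeal k g) (ι k g u))

theorem mem_ghostInvariants (q : Env k g ⧸ evenLeftIdeal k g) :
    q ∈ ghostInvariants k g ↔ ∀ u : g, ι k g u • q = 0 := by
  simp [ghostInvariants]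

end GhostElement

end LieSuperalgebra

open LieSuperalgebra

/-! Fix an ordered basis `b` of `g₁` and write `b_S` for the ordered product of the basis vectors
indexed by a finite set `S`. Everything rests on a relative Poincaré–Birkhoff–Witt theorem: `Ug` is
free as a right `Ug₀`-module on the `b_S`, so the module induced from `M` has the functions `Finset
ι → M` as a model. Spanning is the usual straightening (`filt_le_map_monomialSum`). Independence
comes from constructing the action of `g` on the model by hand (`act`) and checking the superbracket
relations on it (`defect_act_single`).

For the first claim, `φ` fixes `g₀`, so `ad_φ` restricts on `Ug₀` to the adjoint action of `g₀`, and
Frobenius reciprocity yields the map `a ⊗ w ↦ ad_φ(a)(w)`. For odd `u`, `ad_φ(u)(a)` differs from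
`(u - φ u) a` by the supercommutator of `φ u` and `a`, which does not raise the filtration degree.
Since `φ` has no nonzero odd fixed vector, the elements `b_i - φ b_i` form another basis `b'` of
`g₁`. Hence `∑ ad_φ(b_S)(w_S)` and `∑ b'_S w_S` have the same leading term. This gives surjectivity
by induction on the degree, and injectivity by counting dimensions in each filtration step.

For the second claim, consider the top coefficient `v ↦ v univ` of the model. An even `x` acts on it
with an additional scalar `tr (ad x)` on `g₁`, so under the trace hypothesis it is `g₀`-equivariant.
It is also nondegenerate: `v = 0` if `a v` has top coefficient `0` for all `a`
(`eq_zero_of_oddRep_apply_univ`). Therefore a `g`-invariant vector is determined by its top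
coefficient, which is `g₀`-invariant. For `M = k` the model is `Ug / Ug g₀`, and nondegeneracy in
finite dimension produces a nonzero invariant, unique up to scalars. For `M = Ug₀` the
`g₀`-invariants are the centre; a representative `v` of a ghost invariant sends `1 ⊗ z` to an
invariant with top coefficient `c z`, where `c ≠ 0`, which gives the second isomorphism. -/

namespace LieSuperalgebra

/-! ### Functions with prescribed support, and linear algebra on an odd basis -/

section Supported

variable {k : Type*} [Field k] {α : Type*} {M : Type*} [AddCommGroup M] [Module k M]

variable (k M) in
/-- The functions `α → M` which vanish outside of `X`. -/
def supportedIn (X : Set α) : Submodule k (α → M) where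
  carrier := {v | ∀ a, a ∉ X → v a = 0}
  add_mem' hv hw a ha := by simp [hv a ha, hw a ha]
  zero_mem' _ _ := rfl
  smul_mem' c v hv a ha := by simp [hv a ha]

theorem supportedIn_mono {X Y : Set α} (h : X ⊆ Y) : supportedIn k M X ≤ supportedIn k M Y :=
  fun _ hv a ha => hv a fun h' => ha (h h')

variable [DecidableEq α]

theorem single_mem_supportedIn {X : Set α} {a : α} (ha : a ∈ X) (m : M) :
    Pi.single a m ∈ supportedIn k M X := by
  intro c hc
  rw [Pi.single_eq_of_ne]
  rintro rfl
  exact hc ha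

theorem supportedIn_le [Finite α] {X : Set α} {Q : Submodule k (α → M)}
    (h : ∀ a ∈ X, ∀ m : M, Pi.single a m ∈ Q) : supportedIn k M X ≤ Q := by
  intro v hv
  have := Fintype.ofFinite α
  rw [← Finset.univ_sum_single v]
  refine Q.sum_mem fun a _ => ?_
  by_cases ha : a ∈ X
  · exact h a ha _
  · rw [hv a ha, Pi.single_zero]
    exact Q.zero_mem

theorem map_mem_of_supportedIn [Finite α] {P : Type*} [AddCommGroup P] [Module k P] {X : Set α}
    {Q : Submodule k P} (f : (α → M) →ₗ[k] P) (h : ∀ a ∈ X, ∀ m : M, f (Pi.single a m) ∈ Q)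
    {v : α → M} (hv : v ∈ supportedIn k M X) : f v ∈ Q :=
  supportedIn_le (Q := Q.comap f) h hv

theorem eq_of_supportedIn [Finite α] {P : Type*} [AddCommGroup P] [Module k P] {X : Set α}
    (f f' : (α → M) →ₗ[k] P) (h : ∀ a ∈ X, ∀ m : M, f (Pi.single a m) = f' (Pi.single a m))
    {v : α → M} (hv : v ∈ supportedIn k M X) : f v = f' v :=
  supportedIn_le (Q := LinearMap.eqLocus f f') h hv

end Supported

section Assemble

variable {k g : Type*} [Field k] [AddCommGroup g] [Module k g]
variable {α : Type*} [Fintype α] [DecidableEq α] {M : Type*} [AddCommGroup M] [Module k M]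

/-- The action of `g` on `α → M` with prescribed values on functions concentrated at one
point. -/
noncomputable def assemble (A : α → g →ₗ[k] M →ₗ[k] (α → M)) :
    g →ₗ[k] Module.End k (α → M) :=
  ∑ S, LinearMap.lcomp k _ (LinearMap.proj S) ∘ₗ A S

theorem assemble_single (A : α → g →ₗ[k] M →ₗ[k] (α → M)) (x : g) (S : α)
    (m : M) : assemble A x (Pi.single S m) = A S x m := by
  rw [assemble, LinearMap.sum_apply, LinearMap.sum_apply, Finset.sum_eq_single S]
  · simp
  · intro T _ hT
    simp [hT]
  · simp

end Assemble

section OddBasis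

variable {k g : Type*} [Field k] [AddCommGroup g] [Module k g] [LieSuperalgebra k g]
variable {ι : Type*} (b : Module.Basis ι k (odd k g))

/-- The linear map on `g` with given restriction to `g₀` and given values on a basis of `g₁`. -/
noncomputable def glue {Q : Type*} [AddCommGroup Q] [Module k Q] (E : even k g →ₗ[k] Q)
    (O : ι → Q) : g →ₗ[k] Q :=
  E ∘ₗ (even k g).projectionOnto (odd k g) isCompl_part +
    b.constr k O ∘ₗ (odd k g).projectionOnto (even k g) isCompl_part.symm

theorem glue_even {Q : Type*} [AddCommGroup Q] [Module k Q] (E : even k g →ₗ[k] Q)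
    (O : ι → Q) (x : even k g) : glue b E O x = E x := by
  have h : (odd k g).projectionOnto (even k g) isCompl_part.symm (x : g) = 0 :=
    Submodule.projectionOnto_apply_right _ x
  simp [glue, h]

theorem glue_odd {Q : Type*} [AddCommGroup Q] [Module k Q] (E : even k g →ₗ[k] Q)
    (O : ι → Q) (i : ι) : glue b E O (b i) = O i := by
  have h : (even k g).projectionOnto (odd k g) isCompl_part (b i : g) = 0 :=
    Submodule.projectionOnto_apply_right _ _
  simp [glue, h]

/-- Induction for linear conditions on an odd element. -/
theorem odd_mem_of_basis {Q : Submodule k g} (h : ∀ i, (b i : g) ∈ Q) {y : g} (hy : y ∈ odd k g) :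
    y ∈ Q := by
  have : (⊤ : Submodule k (odd k g)) ≤ Q.comap (odd k g).subtype := by
    rw [← b.span_eq, Submodule.span_le]
    rintro _ ⟨i, rfl⟩
    exact h i
  exact this (Submodule.mem_top (x := ⟨y, hy⟩))

end OddBasis

section MinInsert

variable {ι : Type*} [LinearOrder ι]

theorem insert_min' {i : ι} {T : Finset ι} (h : ∀ l ∈ T, i < l) :
    (insert i T).min' (Finset.insert_nonempty _ _) = i :=
  le_antisymm (Finset.min'_le _ _ (Finset.mem_insert_self _ _))
    (Finset.le_min' _ _ _ fun l hl => by
      rcases Finset.mem_insert.1 hl with rfl | hl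
      · exact le_rfl
      · exact (h l hl).le)

theorem notMem_of_forall_lt {i : ι} {T : Finset ι} (h : ∀ l ∈ T, i < l) : i ∉ T :=
  fun hi => lt_irrefl _ (h i hi)

theorem exists_eq_insert {S : Finset ι} (hn : S.Nonempty) :
    ∃ (i : ι) (T : Finset ι), (∀ l ∈ T, i < l) ∧ S = insert i T :=
  ⟨S.min' hn, S.erase (S.min' hn), fun _ hl => Finset.min'_lt_of_mem_erase_min' _ _ hl,
    (Finset.insert_erase (Finset.min'_mem _ _)).symm⟩

end MinInsert

/-! ### The action of `g` on the model of the induced module -/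

section Construction

variable {k g : Type*} [Field k] [AddCommGroup g] [Module k g] [LieSuperalgebra k g]
variable {ι : Type*} [LinearOrder ι] [Fintype ι] (b : Module.Basis ι k (odd k g))
variable {M : Type*} [AddCommGroup M] [Module k M] (ρ : even k g →ₗ[k] Module.End k M)

/-- The action on the basis vectors where it needs no rewriting, and `0` elsewhere. -/
noncomputable def actBase (S : Finset ι) : g →ₗ[k] M →ₗ[k] (Finset ι → M) :=
  glue b (if S = ∅ then (LinearMap.compRight k (LinearMap.single k (fun _ => M) ∅)) ∘ₗ ρ else 0)
    (fun j => if ∀ l ∈ S, j < l then LinearMap.single k (fun _ => M) (insert j S) else 0)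

/-- Moving an even element past the odd basis element `b i`. -/
noncomputable def actStepEven (F : g →ₗ[k] Module.End k (Finset ι → M)) (i : ι) (T : Finset ι) :
    even k g →ₗ[k] M →ₗ[k] (Finset ι → M) :=
  LinearMap.mk₂ k (fun x m => F (b i) (F x (Pi.single T m)) +
      F (bracket (k := k) (x : g) (b i)) (Pi.single T m))
    (fun x y m => by simp only [Submodule.coe_add, map_add, LinearMap.add_apply]; abel)
    (fun c x m => by simp)
    (fun x m n => by simp only [Pi.single_add, map_add]; abel)
    (fun c x m => by simp [Pi.single_smul'])

/-- Moving the odd basis element `b j` past the odd basis element `b i`. -/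
noncomputable def actStepOdd (F : g →ₗ[k] Module.End k (Finset ι → M)) (i : ι) (T : Finset ι)
    (j : ι) : M →ₗ[k] (Finset ι → M) :=
  if j = i then
    -- The square of an odd element is half of its bracket with itself.
    (2⁻¹ : k) • F (bracket (k := k) (b i : g) (b i)) ∘ₗ LinearMap.single k (fun _ => M) T
  else if i < j then
    -(F (b i) ∘ₗ F (b j) ∘ₗ LinearMap.single k (fun _ => M) T) +
      F (bracket (k := k) (b j : g) (b i)) ∘ₗ LinearMap.single k (fun _ => M) T
  else LinearMap.single k (fun _ => M) (insert j (insert i T))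

/-- One step of the recursion which defines the action of `g`. -/
noncomputable def actStep (F : g →ₗ[k] Module.End k (Finset ι → M)) (S : Finset ι) :
    g →ₗ[k] M →ₗ[k] (Finset ι → M) :=
  if h : S.Nonempty then
    glue b (actStepEven b F (S.min' h) (S.erase (S.min' h)))
      (actStepOdd b F (S.min' h) (S.erase (S.min' h)))
  else actBase b ρ S

/-- Approximations to the action of `g`; the `p`-th one is right on the subsets with at most `p`
elements. -/
noncomputable def actApprox : ℕ → Finset ι → g →ₗ[k] M →ₗ[k] (Finset ι → M)
  | 0, S => actBase b ρ S
  | p + 1, S => if S.card = p + 1 then actStep b ρ (assemble (actApprox p)) S else actApprox p S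

/-- The action of `g` on `Finset ι → M`. -/
noncomputable def act : g →ₗ[k] Module.End k (Finset ι → M) :=
  assemble fun S => actApprox b ρ S.card S

theorem actApprox_of_lt {p : ℕ} {S : Finset ι} (h : p < S.card) :
    actApprox b ρ p S = actBase b ρ S := by
  induction p with
  | zero => rfl
  | succ p ih => rw [actApprox, if_neg (by omega), ih (by omega)]

theorem actApprox_of_le {p : ℕ} {S : Finset ι} (h : S.card ≤ p) :
    actApprox b ρ p S = actApprox b ρ S.card S := by
  induction p, h using Nat.le_induction with
  | base => rfl
  | succ p h ih => rw [actApprox, if_neg (by omega), ih]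

theorem actApprox_insert {i : ι} {T : Finset ι} (h : ∀ l ∈ T, i < l) :
    actApprox b ρ (insert i T).card (insert i T) =
      glue b (actStepEven b (assemble (actApprox b ρ T.card)) i T)
        (actStepOdd b (assemble (actApprox b ρ T.card)) i T) := by
  have hi := notMem_of_forall_lt h
  have hc : (insert i T).card = T.card + 1 := Finset.card_insert_of_notMem hi
  have hn : (insert i T).Nonempty := Finset.insert_nonempty _ _
  rw [hc, actApprox, if_pos hc, actStep, dif_pos hn, insert_min' h, Finset.erase_insert hi]

theorem act_even_empty (x : even k g) (m : M) :
    act b ρ x (Pi.single ∅ m) = Pi.single ∅ (ρ x m) := by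
  rw [act, assemble_single]
  simp [actApprox, actBase, glue_even]

theorem actBase_of_lt {j : ι} {S : Finset ι} (h : ∀ l ∈ S, j < l) (m : M) :
    actBase b ρ S (b j) m = Pi.single (insert j S) m := by
  rw [actBase, glue_odd, if_pos h]
  rfl

/-- The default values in `actBase` are chosen for this. Rewriting `b j` past `b i` applies `b i` to
a vector with a term at `insert j T`, one element beyond the level that the approximation controls.
As `i` lies below all indices there, every approximation is already right on that term. -/
theorem actApprox_of_forall_lt {j : ι} {S : Finset ι} (h : ∀ l ∈ S, j < l) (p : ℕ) (m : M) :
    actApprox b ρ p S (b j) m = Pi.single (insert j S) m := by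
  rcases lt_or_ge p S.card with hp | hp
  · rw [actApprox_of_lt b ρ hp, actBase_of_lt b ρ h]
  rw [actApprox_of_le b ρ hp]
  rcases S.eq_empty_or_nonempty with rfl | hn
  · exact actBase_of_lt b ρ h m
  obtain ⟨i, T, hT, rfl⟩ : ∃ (i : ι) (T : Finset ι), (∀ l ∈ T, i < l) ∧ S = insert i T :=
    ⟨S.min' hn, S.erase (S.min' hn), fun l hl => Finset.min'_lt_of_mem_erase_min' _ _ hl,
      (Finset.insert_erase (Finset.min'_mem _ _)).symm⟩
  have hji : j < i := h i (Finset.mem_insert_self _ _)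
  rw [actApprox_insert b ρ hT, glue_odd, actStepOdd, if_neg hji.ne, if_neg hji.not_gt]
  rfl

theorem act_odd_of_lt {j : ι} {S : Finset ι} (h : ∀ l ∈ S, j < l) (m : M) :
    act b ρ (b j) (Pi.single S m) = Pi.single (insert j S) m := by
  rw [act, assemble_single]
  exact actApprox_of_forall_lt b ρ h _ _

variable {b ρ}

theorem assemble_actApprox {p : ℕ} {v : Finset ι → M}
    (hv : v ∈ supportedIn k M {S | S.card ≤ p}) (x : g) :
    assemble (actApprox b ρ p) x v = act b ρ x v := by
  refine eq_of_supportedIn _ _ (fun S hS m => ?_) hv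
  rw [act, assemble_single, assemble_single, actApprox_of_le b ρ hS]

theorem assemble_actApprox_odd {p : ℕ} {i : ι} {v : Finset ι → M}
    (hv : v ∈ supportedIn k M {S | S.card ≤ p ∨ ∀ l ∈ S, i < l}) :
    assemble (actApprox b ρ p) (b i) v = act b ρ (b i) v := by
  refine eq_of_supportedIn _ _ (fun S hS m => ?_) hv
  rw [act, assemble_single, assemble_single]
  rcases hS with hS | hS
  · rw [actApprox_of_le b ρ hS]
  · rw [actApprox_of_forall_lt b ρ hS, actApprox_of_forall_lt b ρ hS]

variable (b ρ)

/-- The action of an even element preserves the filtration by cardinality. -/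
def EvenBound (S : Finset ι) : Prop := ∀ (x : even k g) (m : M),
  act b ρ x (Pi.single S m) ∈ supportedIn k M {T | T.card ≤ S.card}

/-- The leading term of `b j` times a basis vector at `S` is concentrated at `insert j S`. -/
def OddBound (S : Finset ι) : Prop := ∀ (j : ι) (m : M),
  act b ρ (b j) (Pi.single S m) ∈
    supportedIn k M {T | T.card ≤ S.card ∨ (j ∉ S ∧ T = insert j S)}

variable {b ρ}

/-- The recursion with its approximations replaced by `act`. The bound `hE` keeps the vector to
which `b i` is applied within the level where the approximation is right. -/
theorem act_even_insert {i : ι} {T : Finset ι} (h : ∀ l ∈ T, i < l) (hE : EvenBound b ρ T)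
    (x : even k g) (m : M) :
    act b ρ x (Pi.single (insert i T) m) =
      act b ρ (b i) (act b ρ x (Pi.single T m)) +
        act b ρ (bracket (k := k) (x : g) (b i)) (Pi.single T m) := by
  have hT (m : M) : Pi.single T m ∈ supportedIn k M {S : Finset ι | S.card ≤ T.card} :=
    single_mem_supportedIn (by simp) m
  rw [act, assemble_single, actApprox_insert b ρ h, glue_even, actStepEven, LinearMap.mk₂_apply,
    assemble_actApprox (hT m), assemble_actApprox (hT m), assemble_actApprox (hE x m)]
  rfl

theorem act_odd_insert_self {i : ι} {T : Finset ι} (h : ∀ l ∈ T, i < l) (m : M) :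
    act b ρ (b i) (Pi.single (insert i T) m) =
      (2⁻¹ : k) • act b ρ (bracket (k := k) (b i : g) (b i)) (Pi.single T m) := by
  have hT (m : M) : Pi.single T m ∈ supportedIn k M {S : Finset ι | S.card ≤ T.card} :=
    single_mem_supportedIn (by simp) m
  rw [act, assemble_single, actApprox_insert b ρ h, glue_odd, actStepOdd, if_pos rfl,
    LinearMap.smul_apply, LinearMap.comp_apply, LinearMap.coe_single, assemble_actApprox (hT m)]
  rfl

theorem act_odd_insert_of_lt {i j : ι} {T : Finset ι} (h : ∀ l ∈ T, i < l) (hij : i < j)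
    (hO : OddBound b ρ T) (m : M) :
    act b ρ (b j) (Pi.single (insert i T) m) =
      -act b ρ (b i) (act b ρ (b j) (Pi.single T m)) +
        act b ρ (bracket (k := k) (b j : g) (b i)) (Pi.single T m) := by
  have hT (m : M) : Pi.single T m ∈ supportedIn k M {S : Finset ι | S.card ≤ T.card} :=
    single_mem_supportedIn (by simp) m
  rw [act, assemble_single, actApprox_insert b ρ h, glue_odd, actStepOdd, if_neg hij.ne',
    if_pos hij, LinearMap.add_apply, LinearMap.neg_apply, LinearMap.comp_apply,
    LinearMap.comp_apply, LinearMap.comp_apply, LinearMap.coe_single, assemble_actApprox (hT m),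
    assemble_actApprox (hT m), assemble_actApprox_odd]
  · rfl
  · refine supportedIn_mono ?_ (hO j m)
    rintro S (hS | ⟨_, rfl⟩)
    · exact Or.inl hS
    -- The set `insert j T` is too large for the approximation, but `i` is below all of its
    -- elements.
    · refine Or.inr fun l hl => ?_
      rcases Finset.mem_insert.1 hl with rfl | hl
      · exact hij
      · exact h l hl

theorem act_odd_mem {p : ℕ} (hO : ∀ S : Finset ι, S.card ≤ p → OddBound b ρ S) {y : g}
    (hy : y ∈ odd k g) {v : Finset ι → M} (hv : v ∈ supportedIn k M {S | S.card ≤ p}) :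
    act b ρ y v ∈ supportedIn k M {S | S.card ≤ p + 1} := by
  refine odd_mem_of_basis b
    (Q := (supportedIn k M {S | S.card ≤ p + 1}).comap ((act b ρ).flip v)) (fun j => ?_) hy
  refine map_mem_of_supportedIn (Q := supportedIn k M {S | S.card ≤ p + 1}) (act b ρ (b j))
    (fun S hS m => ?_) hv
  refine supportedIn_mono ?_ (hO S hS j m)
  have hS' : S.card ≤ p := hS
  rintro T (hT | ⟨_, rfl⟩)
  · exact le_trans hT (by omega)
  · exact (Finset.card_insert_le _ _).trans (by omega)

/-- The two bounds need each other: moving an even element past `b i` leaves an odd bracket, and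
moving an odd one past it leaves an even bracket. Both brackets act on the smaller set `T`. -/
theorem act_bounds (S : Finset ι) : EvenBound b ρ S ∧ OddBound b ρ S := by
  induction hp : S.card using Nat.strong_induction_on generalizing S with
  | _ p ih =>
  subst hp
  rcases S.eq_empty_or_nonempty with rfl | hn
  · refine ⟨fun x m => ?_, fun j m => ?_⟩
    · rw [act_even_empty]
      exact single_mem_supportedIn (by simp) _
    · rw [act_odd_of_lt b ρ (by simp)]
      exact single_mem_supportedIn (by simp) _
  obtain ⟨i, T, h, rfl⟩ := exists_eq_insert hn
  have hi := notMem_of_forall_lt h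
  have hc : (insert i T).card = T.card + 1 := Finset.card_insert_of_notMem hi
  rw [hc] at ih
  have hE : EvenBound b ρ T := (ih T.card (by omega) T rfl).1
  have hO (S : Finset ι) (hS : S.card ≤ T.card) : OddBound b ρ S := (ih S.card (by omega) S rfl).2
  have hT (m : M) : Pi.single T m ∈ supportedIn k M {S : Finset ι | S.card ≤ T.card} :=
    single_mem_supportedIn (by simp) m
  have hbr (x y : g) (hx : x ∈ odd k g) (hy : y ∈ odd k g) (m : M) :
      act b ρ (bracket (k := k) x y) (Pi.single T m) ∈ supportedIn k M {S | S.card ≤ T.card + 1} :=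
    supportedIn_mono (X := {S : Finset ι | S.card ≤ T.card}) (fun _ hS => Nat.le_succ_of_le hS)
      (hE ⟨_, (by simpa using! bracket_mem hx hy : bracket x y ∈ even k g)⟩ m)
  refine ⟨fun x m => ?_, fun j m => ?_⟩
  · rw [act_even_insert h hE, hc]
    refine Submodule.add_mem _ (act_odd_mem hO (b i).2 (hE x m)) (act_odd_mem hO ?_ (hT m))
    simpa using bracket_mem x.2 (b i).2
  · rcases lt_trichotomy j i with hji | rfl | hij
    · have hj : ∀ l ∈ insert i T, j < l := fun l hl => by
        rcases Finset.mem_insert.1 hl with rfl | hl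
        · exact hji
        · exact hji.trans (h l hl)
      rw [act_odd_of_lt b ρ hj]
      exact single_mem_supportedIn (by exact Or.inr ⟨notMem_of_forall_lt hj, rfl⟩) _
    · rw [act_odd_insert_self h, hc]
      refine supportedIn_mono (fun S hS => Or.inl hS) (Submodule.smul_mem _ _ (hbr _ _ ?_ ?_ m))
      exacts [(b j).2, (b j).2]
    · rw [act_odd_insert_of_lt h hij (hO T le_rfl), hc]
      refine Submodule.add_mem _ (Submodule.neg_mem _ ?_)
        (supportedIn_mono (fun S hS => Or.inl hS) (hbr _ _ (b j).2 (b i).2 m))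
      refine map_mem_of_supportedIn (act b ρ (b i)) ?_ (hO T le_rfl j m)
      rintro S (hS | ⟨hj, rfl⟩) m
      · exact supportedIn_mono (fun S hS => Or.inl hS)
          (act_odd_mem hO (b i).2 (single_mem_supportedIn (by exact hS) m))
      · rw [act_odd_of_lt]
        · refine single_mem_supportedIn ?_ _
          exact Or.inr ⟨by simp [hij.ne', hj], Finset.insert_comm _ _ _⟩
        · intro l hl
          rcases Finset.mem_insert.1 hl with rfl | hl
          · exact hij
          · exact h l hl

end Construction


theorem koszulSign_add_right : ∀ i j l : ZMod 2,
    koszulSign i (j + l) = koszulSign i j * koszulSign i l := by decide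

theorem koszulSign_add_left : ∀ i j l : ZMod 2,
    koszulSign (i + j) l = koszulSign i l * koszulSign j l := by decide

theorem koszulSign_comm : ∀ i j : ZMod 2, koszulSign i j = koszulSign j i := by decide

theorem koszulSign_mul_self : ∀ i j : ZMod 2, koszulSign i j * koszulSign i j = 1 := by decide

/-! ### The superbracket relations on the model -/

section Defect

variable {k g : Type*} [Field k] [AddCommGroup g] [Module k g] [LieSuperalgebra k g]
variable {N : Type*} [AddCommGroup N] [Module k N] (a : g →ₗ[k] Module.End k N)

/-- The failure of a linear map `g → End N` to respect the superbracket of elements of parities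
`i` and `j`. -/
def defect (i j : ZMod 2) : g →ₗ[k] g →ₗ[k] Module.End k N :=
  LinearMap.mk₂ k
    (fun x y => a x * a y - koszulSign i j • (a y * a x) - a (bracket (k := k) x y))
    (fun x x' y => by simp only [map_add, LinearMap.add_apply, add_mul, mul_add, smul_add]; abel)
    (fun c x y => by
      simp only [map_smul, LinearMap.smul_apply, smul_mul_assoc, mul_smul_comm, smul_sub,
        smul_comm c (koszulSign i j)])
    (fun x y y' => by simp only [map_add, add_mul, mul_add, smul_add]; abel)
    (fun c x y => by
      simp only [map_smul, smul_mul_assoc, mul_smul_comm, smul_sub, smul_comm c (koszulSign i j)])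

variable {a}

theorem defect_eq_zero_iff {i j : ZMod 2} {x y : g} {v : N} :
    defect a i j x y v = 0 ↔
      a x (a y v) = koszulSign i j • a y (a x v) + a (bracket (k := k) x y) v := by
  rw [defect, LinearMap.mk₂_apply, LinearMap.sub_apply, LinearMap.sub_apply, LinearMap.smul_apply,
    Module.End.mul_apply, Module.End.mul_apply, sub_sub, sub_eq_zero]

theorem defect_symm {i j : ZMod 2} {x y : g} (hx : x ∈ part (k := k) i) (hy : y ∈ part (k := k) j)
    {v : N} (h : defect a i j x y v = 0) : defect a j i y x v = 0 := by
  rw [defect_eq_zero_iff] at h ⊢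
  rw [h, bracket_skew hy hx, koszulSign_comm j i, smul_add, smul_smul, koszulSign_mul_self]
  simp

/-- The relations for `x, y` on `z v` follow from relations of `x, y, z` on smaller vectors. -/
theorem defect_step {i j l : ZMod 2} {x y z : g} (hx : x ∈ part (k := k) i)
    (hy : y ∈ part (k := k) j) {v : N}
    (hxz : defect a i l x z v = 0) (hyz : defect a j l y z v = 0) (hxy : defect a i j x y v = 0)
    (hxzy : defect a i l x z (a y v) = 0) (hyzx : defect a j l y z (a x v) = 0)
    (h1 : defect a i (j + l) x (bracket (k := k) y z) v = 0)
    (h2 : defect a j (i + l) y (bracket (k := k) x z) v = 0)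
    (h3 : defect a (i + j) l (bracket (k := k) x y) z v = 0) :
    defect a i j x y (a z v) = 0 := by
  rw [defect_eq_zero_iff] at *
  have hJ := congrArg (fun t => a t v) (bracket_jacobi (k := k) z hx hy)
  simp only [map_add, map_zsmul, LinearMap.add_apply, LinearMap.smul_apply] at hJ
  -- Move `z` to the front in `x y z v` and in `y x z v`. The mixed terms with `[x, z] y` and `[y,
  -- z] x` agree on both sides, and Jacobi accounts for the iterated brackets.
  rw [hyz, hxz, h3, map_add, map_zsmul, hxzy, map_add, map_zsmul, hyzx, h1, h2, hxy, hJ]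
  have e := koszulSign_mul_self i j
  simp only [koszulSign_add_left, koszulSign_add_right, map_add, map_zsmul, smul_add, smul_smul,
    koszulSign_comm j i]
  rw [show koszulSign i j * (koszulSign i j * koszulSign j l) = koszulSign j l by
    rw [← mul_assoc, e, one_mul]]
  module

/-- The relations for `x, z` on `z v`, with `z` odd, follow from relations on smaller vectors. -/
theorem defect_step_self [CharZero k] {i : ZMod 2} {x z : g} (hx : x ∈ part (k := k) i)
    (hz : z ∈ odd k g) {v : N}
    (hzz : defect a 1 1 z z v = 0) (hxz : defect a i 1 x z v = 0)
    (hzzx : defect a 1 1 z z (a x v) = 0)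
    (h1 : defect a i 0 x (bracket (k := k) z z) v = 0)
    (h2 : defect a (i + 1) 1 (bracket (k := k) x z) z v = 0) :
    defect a i 1 x z (a z v) = 0 := by
  have hdouble {u : N} (h : defect a 1 1 z z u = 0) : (2 : k) • a z (a z u) =
      a (bracket (k := k) z z) u := by
    rw [defect_eq_zero_iff, koszulSign_one_one] at h
    rw [two_smul]
    nth_rewrite 1 [h]
    module
  have h4 := hdouble hzz
  have h5 := hdouble hzzx
  rw [defect_eq_zero_iff] at *
  have hxz' := bracket_mem (k := k) hx hz
  have hJ := congrArg (fun t => a t v) (bracket_jacobi (k := k) z hx hz)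
  have hS := bracket_skew (k := k) hz hxz'
  simp only [map_add, map_zsmul, LinearMap.add_apply, LinearMap.smul_apply, hS, map_neg,
    LinearMap.neg_apply] at hJ
  have h6 := congrArg (a x) h4
  rw [map_smul, h1, koszulSign_zero_right, one_smul] at h6
  have h7 := congrArg (a z) hxz
  rw [map_add, map_zsmul] at h7
  rw [h7, h2]
  -- After doubling, `z z` can be replaced by the even element `[z, z]`, both on `v` and on `a x v`.
  have h2' : (2 : k) ≠ 0 := two_ne_zero
  refine smul_right_injective N h2' ?_
  dsimp only
  rw [h6, hJ, ← h5]
  simp only [koszulSign_add_left, koszulSign_add_right, koszulSign_comm 1 i, koszulSign_one_one,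
    smul_add, smul_neg, smul_smul, smul_comm (2 : k)]
  rcases zmod_two_cases i with rfl | rfl <;>
  simp only [koszulSign_zero_left, koszulSign_one_one] <;> module

/-- The relations for `z, z` on `z v`, with `z` odd, follow from relations on smaller vectors. -/
theorem defect_step_self_self [CharZero k] {z : g} (hz : z ∈ odd k g) {v : N}
    (hzz : defect a 1 1 z z v = 0)
    (h2 : defect a 0 1 (bracket (k := k) z z) z v = 0) :
    defect a 1 1 z z (a z v) = 0 := by
  rw [defect_eq_zero_iff] at *
  have hz2 : bracket (k := k) z z ∈ part (k := k) (g := g) 0 := by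
    simpa using! bracket_mem (k := k) hz hz
  have hJ := bracket_jacobi (k := k) z hz hz
  rw [koszulSign_one_one, bracket_skew hz hz2, koszulSign_zero_right, one_smul] at hJ
  -- Skew-symmetry turns `[z, [z, z]]` into `-[[z, z], z]`, so Jacobi says that three times this
  -- bracket vanishes; hence `[z, z]` commutes with `z`.
  have h3 : (3 : k) • bracket (k := k) (bracket (k := k) z z) z = 0 := by
    linear_combination (norm := module) -hJ
  rw [smul_eq_zero_iff_right three_ne_zero] at h3
  have h4 := congrArg (a z) hzz
  rw [map_add, map_zsmul, koszulSign_one_one] at h4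
  rw [h2, h3, koszulSign_zero_left, koszulSign_one_one, one_smul, map_zero, LinearMap.zero_apply,
    add_zero]
  rw [koszulSign_one_one] at hzz
  exact h4

end Defect

section Generators

variable {k g : Type*} [Field k] [AddCommGroup g] [Module k g] [LieSuperalgebra k g]
variable {ι : Type*} [LinearOrder ι] {b : Module.Basis ι k (odd k g)}

theorem defect_eq_zero_of_basis {N : Type*} [AddCommGroup N] [Module k N]
    {a : g →ₗ[k] Module.End k N} {v : N}
    (h00 : ∀ x ∈ even k g, ∀ y ∈ even k g, defect a 0 0 x y v = 0)
    (h01 : ∀ x ∈ even k g, ∀ j, defect a 0 1 x (b j : g) v = 0)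
    (h11 : ∀ i j, i ≤ j → defect a 1 1 (b j : g) (b i : g) v = 0)
    (i j : ZMod 2) (x y : g) (hx : x ∈ part (k := k) i) (hy : y ∈ part (k := k) j) :
    defect a i j x y v = 0 := by
  have h01' (x : g) (hx : x ∈ even k g) (y : g) (hy : y ∈ odd k g) : defect a 0 1 x y v = 0 :=
    odd_mem_of_basis b (Q := LinearMap.ker ((defect a 0 1 x).flip v)) (fun j => h01 x hx j) hy
  have h11' (i j : ι) : defect a 1 1 (b j : g) (b i : g) v = 0 := by
    rcases le_total i j with hij | hij
    · exact h11 i j hij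
    · exact defect_symm (b i).2 (b j).2 (h11 j i hij)
  have h11'' (x : g) (hx : x ∈ odd k g) (j : ι) : defect a 1 1 x (b j : g) v = 0 :=
    odd_mem_of_basis b (Q := LinearMap.ker (((defect a 1 1).flip (b j : g)).flip v))
      (fun i => h11' j i) hx
  rcases zmod_two_cases i with rfl | rfl <;> rcases zmod_two_cases j with rfl | rfl
  · exact h00 x hx y hy
  · exact h01' x hx y hy
  · exact defect_symm hy hx (h01' y hy x hx)
  · exact odd_mem_of_basis b (Q := LinearMap.ker ((defect a 1 1 x).flip v))
      (fun j => h11'' x hx j) hy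

end Generators

section Relations

variable {k g : Type*} [Field k] [AddCommGroup g] [Module k g] [LieSuperalgebra k g]
variable {ι : Type*} [LinearOrder ι] [Fintype ι] {b : Module.Basis ι k (odd k g)}
variable {M : Type*} [AddCommGroup M] [Module k M] {ρ : even k g →ₗ[k] Module.End k M}

/-- When `z` lies below `T`, applying `b z` is just insertion, so this relation is the recursion
itself. The same holds for `defect_act_basis_of_le`. -/
theorem defect_act_even_basis {z : ι} {T : Finset ι} (h : ∀ l ∈ T, z < l) {x : g}
    (hx : x ∈ even k g) (m : M) :
    defect (act b ρ) 0 1 x (b z : g) (Pi.single T m) = 0 := by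
  rw [defect_eq_zero_iff, act_odd_of_lt b ρ h, koszulSign_zero_left, one_smul]
  exact act_even_insert h (act_bounds T).1 ⟨x, hx⟩ m

theorem defect_act_basis_of_le [CharZero k] {z j : ι} {T : Finset ι} (h : ∀ l ∈ T, z < l)
    (hj : z ≤ j) (m : M) :
    defect (act b ρ) 1 1 (b j : g) (b z) (Pi.single T m) = 0 := by
  rw [defect_eq_zero_iff, act_odd_of_lt b ρ h, koszulSign_one_one]
  rcases hj.eq_or_lt with rfl | hj
  · rw [act_odd_of_lt b ρ h, act_odd_insert_self h]
    module
  · rw [act_odd_insert_of_lt h hj (act_bounds T).2]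
    module

variable [CharZero k]

/-- `act` is a representation, checked on one basis vector. -/
theorem defect_act_single (hρ : ∀ x y : even k g, ρ ⁅x, y⁆ = ρ x * ρ y - ρ y * ρ x)
    (S : Finset ι) (m : M) (i j : ZMod 2) (x y : g) (hx : x ∈ part (k := k) i)
    (hy : y ∈ part (k := k) j) : defect (act b ρ) i j x y (Pi.single S m) = 0 := by
  induction hp : S.card using Nat.strong_induction_on generalizing S m i j x y with
  | _ p ih =>
  subst hp
  rcases S.eq_empty_or_nonempty with rfl | hn
  · refine defect_eq_zero_of_basis (b := b) (fun x hx y hy => ?_)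
      (fun x hx j => defect_act_even_basis (by simp) hx m)
      (fun i j hij => defect_act_basis_of_le (by simp) hij m) i j x y hx hy
    rw [defect_eq_zero_iff]
    lift x to even k g using hx
    lift y to even k g using hy
    rw [← coe_even_bracket, act_even_empty, act_even_empty, act_even_empty, act_even_empty,
      act_even_empty, koszulSign_zero_left, one_smul, hρ, ← Pi.single_add]
    simp
  obtain ⟨z, T, h, rfl⟩ := exists_eq_insert hn
  have hzT := notMem_of_forall_lt h
  have hc : (insert z T).card = T.card + 1 := Finset.card_insert_of_notMem hzT
  rw [hc] at ih
  revert i j x y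
  clear hn
  have hz := (b z).2
  have IH (i j : ZMod 2) (x y : g) (hx : x ∈ part (k := k) i) (hy : y ∈ part (k := k) j)
      (v : Finset ι → M) (hv : v ∈ supportedIn k M {S | S.card ≤ T.card}) :
      defect (act b ρ) i j x y v = 0 :=
    eq_of_supportedIn _ 0 (fun S hS m =>
      ih S.card (Nat.lt_succ_of_le hS) S m i j x y hx hy rfl) hv
  have hT (m : M) : Pi.single T m ∈ supportedIn k M {S : Finset ι | S.card ≤ T.card} :=
    single_mem_supportedIn (by simp) m
  have IHT (i j : ZMod 2) (x y : g) (hx : x ∈ part (k := k) i) (hy : y ∈ part (k := k) j) :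
      defect (act b ρ) i j x y (Pi.single T m) = 0 := IH i j x y hx hy _ (hT m)
  -- vectors on which the relations with `b z` hold by construction
  have hlead (i : ZMod 2) (x : g) (hx : (i = 0 ∧ x ∈ even k g) ∨ ∃ j, z ≤ j ∧ i = 1 ∧ x = b j)
      (v : Finset ι → M) (hv : v ∈ supportedIn k M {S | S.card ≤ T.card ∨ ∀ l ∈ S, z < l}) :
      defect (act b ρ) i 1 x (b z : g) v = 0 := by
    refine eq_of_supportedIn _ 0 (fun S hS m => ?_) hv
    rcases hS with hS | hS
    · refine IH _ _ _ _ ?_ hz _ (single_mem_supportedIn (by exact hS) m)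
      rcases hx with ⟨rfl, hx⟩ | ⟨j, _, rfl, rfl⟩
      exacts [hx, (b j).2]
    · rcases hx with ⟨rfl, hx⟩ | ⟨j, hj, rfl, rfl⟩
      exacts [defect_act_even_basis hS hx m, defect_act_basis_of_le hS hj m]
  have heven (x : g) (hx : x ∈ even k g) : act b ρ x (Pi.single T m) ∈
      supportedIn k M {S | S.card ≤ T.card ∨ ∀ l ∈ S, z < l} :=
    supportedIn_mono (fun _ hS => Or.inl hS) ((act_bounds T).1 ⟨x, hx⟩ m)
  have hodd (j : ι) (hj : z < j) : act b ρ (b j) (Pi.single T m) ∈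
      supportedIn k M {S | S.card ≤ T.card ∨ ∀ l ∈ S, z < l} := by
    refine supportedIn_mono ?_ ((act_bounds T).2 j m)
    rintro S (hS | ⟨_, rfl⟩)
    · exact Or.inl hS
    · refine Or.inr fun l hl => ?_
      rcases Finset.mem_insert.1 hl with rfl | hl
      exacts [hj, h l hl]
  have hbr {i j : ZMod 2} {x y : g} (hx : x ∈ part (k := k) i) (hy : y ∈ part (k := k) j) :=
    bracket_mem (k := k) hx hy
  have hlt {j : ι} (hj : j < z) : ∀ l ∈ insert z T, j < l := fun l hl => by
    rcases Finset.mem_insert.1 hl with rfl | hl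
    exacts [hj, hj.trans (h l hl)]
  -- The vector at `insert z T` is `b z` applied to the one at `T`, so `defect_step` applies. The
  -- hypotheses `hxT` and `hyT` place the intermediate vectors where `hlead` is available.
  have hmain (i j : ZMod 2) (x y : g)
      (hx : (i = 0 ∧ x ∈ even k g) ∨ ∃ j, z ≤ j ∧ i = 1 ∧ x = b j)
      (hy : (j = 0 ∧ y ∈ even k g) ∨ ∃ l, z ≤ l ∧ j = 1 ∧ y = b l)
      (hx' : x ∈ part (k := k) i) (hy' : y ∈ part (k := k) j)
      (hxT : act b ρ x (Pi.single T m) ∈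
        supportedIn k M {S | S.card ≤ T.card ∨ ∀ l ∈ S, z < l})
      (hyT : act b ρ y (Pi.single T m) ∈
        supportedIn k M {S | S.card ≤ T.card ∨ ∀ l ∈ S, z < l}) :
      defect (act b ρ) i j x y (Pi.single (insert z T) m) = 0 := by
    rw [← act_odd_of_lt b ρ h]
    exact defect_step (l := 1) hx' hy' (IHT _ _ _ _ hx' hz) (IHT _ _ _ _ hy' hz)
      (IHT _ _ _ _ hx' hy') (hlead i x hx _ hyT) (hlead j y hy _ hxT)
      (IHT _ _ _ _ hx' (hbr hy' hz)) (IHT _ _ _ _ hy' (hbr hx' hz)) (IHT _ _ _ _ (hbr hx' hy') hz)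
  have hself (i : ZMod 2) (x : g) (hx' : x ∈ part (k := k) i)
      (hxT : act b ρ x (Pi.single T m) ∈
        supportedIn k M {S | S.card ≤ T.card ∨ ∀ l ∈ S, z < l}) :
      defect (act b ρ) i 1 x (b z : g) (Pi.single (insert z T) m) = 0 := by
    rw [← act_odd_of_lt b ρ h]
    exact defect_step_self hx' hz (IHT _ _ _ _ hz hz) (IHT _ _ _ _ hx' hz)
      (hlead 1 _ (Or.inr ⟨z, le_rfl, rfl, rfl⟩) _ hxT) (IHT _ _ _ _ hx' (hbr hz hz))
      (IHT _ _ _ _ (hbr hx' hz) hz)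
  -- An index below `z` is again smaller than the whole set, so its relation holds by construction;
  -- `z` itself needs the identities for squares; larger indices go through `hmain`.
  refine defect_eq_zero_of_basis (b := b) (fun x hx y hy => ?_) (fun x hx j => ?_)
    (fun i j hij => ?_)
  · exact hmain 0 0 x y (Or.inl ⟨rfl, hx⟩) (Or.inl ⟨rfl, hy⟩) hx hy (heven x hx) (heven y hy)
  · rcases lt_trichotomy j z with hj | rfl | hj
    · exact defect_act_even_basis (hlt hj) hx m
    · exact hself 0 x hx (heven x hx)
    · exact hmain 0 1 x _ (Or.inl ⟨rfl, hx⟩) (Or.inr ⟨j, hj.le, rfl, rfl⟩) hx (b j).2 (heven x hx)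
        (hodd j hj)
  · rcases lt_trichotomy i z with hi | rfl | hi
    · exact defect_act_basis_of_le (hlt hi) hij m
    · rcases hij.eq_or_lt with rfl | hij
      · rw [← act_odd_of_lt b ρ h]
        exact defect_step_self_self hz (IHT _ _ _ _ hz hz) (IHT 0 1 _ _ (hbr hz hz) hz)
      · exact hself 1 _ (b j).2 (hodd j hij)
    · exact hmain 1 1 _ _ (Or.inr ⟨j, hi.le.trans hij, rfl, rfl⟩) (Or.inr ⟨i, hi.le, rfl, rfl⟩)
        (b j).2 (b i).2 (hodd j (hi.trans_le hij)) (hodd i hi)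

variable (b) in
/-- The representation of `Ug` on `Finset ι → M` which extends a representation of `g₀` on `M`. -/
noncomputable def actRep (hρ : ∀ x y : even k g, ρ ⁅x, y⁆ = ρ x * ρ y - ρ y * ρ x) :
    Env k g →ₐ[k] Module.End k (Finset ι → M) :=
  Env.lift (act b ρ) fun i j x y hx hy => by
    refine LinearMap.ext fun v => ?_
    have h : defect (act b ρ) i j x y = 0 :=
      LinearMap.pi_ext fun S m => defect_act_single hρ S m i j x y hx hy
    exact defect_eq_zero_iff.1 (LinearMap.congr_fun h v)

theorem actRep_ι (hρ : ∀ x y : even k g, ρ ⁅x, y⁆ = ρ x * ρ y - ρ y * ρ x) (x : g) :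
    actRep b hρ (Env.ι k g x) = act b ρ x :=
  Env.lift_ι _ _ x

end Relations


/-! ### Filtrations of `Ug` and `Ug₀` by word length -/

section WordFiltration

variable {k A : Type*} [Field k] [Ring A] [Algebra k A]

/-- The span of the products of at most `d` elements of `V`. -/
def wordFilt (V : Submodule k A) (d : ℕ) : Submodule k A := (1 ⊔ V) ^ d

variable {V : Submodule k A}

theorem wordFilt_mono {d e : ℕ} (h : d ≤ e) : wordFilt V d ≤ wordFilt V e :=
  pow_le_pow_right' (le_sup_left : 1 ≤ 1 ⊔ V) h

theorem mul_mem_wordFilt {d e : ℕ} {x y : A} (hx : x ∈ wordFilt V d) (hy : y ∈ wordFilt V e) :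
    x * y ∈ wordFilt V (d + e) := by
  rw [wordFilt, pow_add]
  exact Submodule.mul_mem_mul hx hy

theorem mem_wordFilt_one {x : A} (hx : x ∈ V) : x ∈ wordFilt V 1 := by
  rw [wordFilt, pow_one]
  exact Submodule.mem_sup_right hx

theorem mem_wordFilt_zero {x : A} : x ∈ wordFilt V 0 ↔ ∃ c : k, algebraMap k A c = x := by
  rw [wordFilt, pow_zero, Submodule.mem_one]

theorem one_mem_wordFilt (d : ℕ) : (1 : A) ∈ wordFilt V d :=
  wordFilt_mono (Nat.zero_le d) (mem_wordFilt_zero.2 ⟨1, map_one _⟩)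

/-- Induction on the number of factors of a word. -/
theorem wordFilt_succ_le {d : ℕ} {Q : Submodule k A} (h0 : ∀ a ∈ wordFilt V d, a ∈ Q)
    (h : ∀ x ∈ V, ∀ a ∈ wordFilt V d, x * a ∈ Q) : wordFilt V (d + 1) ≤ Q := by
  rw [wordFilt, pow_succ', Submodule.mul_le]
  intro x hx a ha
  obtain ⟨c, hc, y, hy, rfl⟩ := Submodule.mem_sup.1 hx
  obtain ⟨c, rfl⟩ := Submodule.mem_one.1 hc
  rw [add_mul, ← Algebra.smul_def]
  exact Q.add_mem (Q.smul_mem _ (h0 a ha)) (h y hy a ha)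

theorem map_wordFilt_le {B : Type*} [Ring B] [Algebra k B] {W : Submodule k B} (f : A →ₐ[k] B)
    (h : ∀ x ∈ V, f x ∈ W) {d : ℕ} {a : A} (ha : a ∈ wordFilt V d) : f a ∈ wordFilt W d := by
  induction d generalizing a with
  | zero =>
    obtain ⟨c, rfl⟩ := mem_wordFilt_zero.1 ha
    exact mem_wordFilt_zero.2 ⟨c, by simp⟩
  | succ d ih =>
    refine wordFilt_succ_le (Q := (wordFilt W (d + 1)).comap f.toLinearMap) (fun a ha => ?_)
      (fun x hx a ha => ?_) ha
    · exact wordFilt_mono (Nat.le_succ d) (ih ha)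
    · simp only [Submodule.mem_comap, AlgHom.toLinearMap_apply, map_mul]
      rw [add_comm]
      exact mul_mem_wordFilt (mem_wordFilt_one (h x hx)) (ih ha)

theorem exists_mem_wordFilt (hV : Algebra.adjoin k (V : Set A) = ⊤) (a : A) :
    ∃ d, a ∈ wordFilt V d := by
  have ha : a ∈ Algebra.adjoin k (V : Set A) := hV ▸ Algebra.mem_top
  induction ha using Algebra.adjoin_induction with
  | mem x hx => exact ⟨1, mem_wordFilt_one hx⟩
  | algebraMap c => exact ⟨0, mem_wordFilt_zero.2 ⟨c, rfl⟩⟩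
  | add x y _ _ hx hy =>
    obtain ⟨d, hx⟩ := hx
    obtain ⟨e, hy⟩ := hy
    exact ⟨max d e, Submodule.add_mem _ (wordFilt_mono (le_max_left _ _) hx)
      (wordFilt_mono (le_max_right _ _) hy)⟩
  | mul x y _ _ hx hy =>
    obtain ⟨d, hx⟩ := hx
    obtain ⟨e, hy⟩ := hy
    exact ⟨d + e, mul_mem_wordFilt hx hy⟩

theorem finite_wordFilt (hV : V.FG) (d : ℕ) : (wordFilt V d).FG :=
  Submodule.FG.pow (Submodule.FG.sup (Submodule.one_eq_span (R := k) (A := A) ▸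
    Submodule.fg_span_singleton 1) hV) d

end WordFiltration

section Generators

variable (k g : Type*) [Field k] [AddCommGroup g] [Module k g] [LieSuperalgebra k g]

theorem Env.adjoin_range_ι : Algebra.adjoin k (Set.range (Env.ι k g)) = ⊤ := by
  have h := congrArg (Subalgebra.map (RingQuot.mkAlgHom k (EnvRel k g)))
    (TensorAlgebra.adjoin_range_ι (R := k) (M := g))
  rw [AlgHom.map_adjoin, ← Set.range_comp, Algebra.map_top,
    (AlgHom.range_eq_top _).2 (RingQuot.mkAlgHom_surjective k (EnvRel k g))] at h
  exact h

attribute [local instance] LieRing.ofAssociativeRing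

theorem adjoin_range_evenι [CharZero k] :
    Algebra.adjoin k (Set.range (UniversalEnvelopingAlgebra.ι k (L := even k g))) = ⊤ := by
  have hs : Function.Surjective (UniversalEnvelopingAlgebra.mkAlgHom k (even k g)) :=
    RingCon.mkₐ_surjective _
  have h := congrArg (Subalgebra.map (UniversalEnvelopingAlgebra.mkAlgHom k (even k g)))
    (TensorAlgebra.adjoin_range_ι (R := k) (M := even k g))
  rw [AlgHom.map_adjoin, ← Set.range_comp, Algebra.map_top,
    (AlgHom.range_eq_top _).2 hs] at h
  exact h

theorem evenIncl_ι [CharZero k] (x : even k g) :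
    evenIncl k g (UniversalEnvelopingAlgebra.ι k x) = Env.ι k g x :=
  UniversalEnvelopingAlgebra.lift_ι_apply k _ x

end Generators

section EnvFiltration

variable (k g : Type*) [Field k] [AddCommGroup g] [Module k g] [LieSuperalgebra k g]

/-- The filtration of `Ug` by the number of factors from `g`. -/
noncomputable abbrev Env.filt (d : ℕ) : Submodule k (Env k g) :=
  wordFilt (LinearMap.range (Env.ι k g)) d

attribute [local instance] LieRing.ofAssociativeRing in
/-- The filtration of `Ug₀` by the number of factors from `g₀`. -/
noncomputable abbrev evenFilt [CharZero k] (d : ℕ) :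
    Submodule k (UniversalEnvelopingAlgebra k (even k g)) :=
  wordFilt (LinearMap.range
    (UniversalEnvelopingAlgebra.ι k :
      even k g →ₗ⁅k⁆ UniversalEnvelopingAlgebra k (even k g)).toLinearMap) d

variable {k g}

theorem Env.ι_mem_filt (x : g) : Env.ι k g x ∈ Env.filt k g 1 := mem_wordFilt_one ⟨x, rfl⟩

theorem Env.exists_mem_filt (a : Env k g) : ∃ d, a ∈ Env.filt k g d :=
  exists_mem_wordFilt (by simpa using! Env.adjoin_range_ι k g) a

theorem Env.filt_fg [Module.Finite k g] (d : ℕ) : (Env.filt k g d).FG :=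
  finite_wordFilt (by rw [LinearMap.range_eq_map]; exact Module.Finite.fg_top.map _) d

theorem Env.ι_mul_mem_filt (x : g) {d : ℕ} {a : Env k g} (ha : a ∈ Env.filt k g d) :
    Env.ι k g x * a ∈ Env.filt k g (d + 1) := by
  rw [add_comm]
  exact mul_mem_wordFilt (Env.ι_mem_filt x) ha

theorem exists_even_add_odd (z : g) : ∃ z₀ ∈ even k g, ∃ z₁ ∈ odd k g, z₀ + z₁ = z :=
  Submodule.mem_sup.1 ((isCompl_part (k := k) (g := g)).sup_eq_top ▸ Submodule.mem_top (x := z))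

theorem Env.ι_even_mul {y : g} (hy : y ∈ even k g) (z : g) :
    Env.ι k g y * Env.ι k g z =
      Env.ι k g z * Env.ι k g y + Env.ι k g (bracket (k := k) y z) := by
  obtain ⟨z₀, h₀, z₁, h₁, rfl⟩ := exists_even_add_odd (k := k) z
  have e₀ := Env.ι_mul_ι hy h₀
  have e₁ := Env.ι_mul_ι hy h₁
  rw [koszulSign_zero_left, one_smul] at e₀ e₁
  simp only [map_add, mul_add, add_mul, e₀, e₁]
  abel

theorem Env.ι_odd_mul {y : g} (hy : y ∈ odd k g) (z : g) :
    Env.ι k g y * Env.ι k g z =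
      Env.parity k g (Env.ι k g z) * Env.ι k g y + Env.ι k g (bracket (k := k) y z) := by
  obtain ⟨z₀, h₀, z₁, h₁, rfl⟩ := exists_even_add_odd (k := k) z
  have e₀ := Env.ι_mul_ι hy h₀
  have e₁ := Env.ι_mul_ι hy h₁
  rw [koszulSign_zero_right, one_smul] at e₀
  rw [koszulSign_one_one, neg_smul, one_smul] at e₁
  simp only [map_add, mul_add, add_mul, e₀, e₁, parity_ι_even h₀, parity_ι_odd h₁, neg_mul]
  abel

theorem Env.parity_mem_filt {d : ℕ} {a : Env k g} (ha : a ∈ Env.filt k g d) :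
    Env.parity k g a ∈ Env.filt k g d := by
  refine map_wordFilt_le _ ?_ ha
  rintro _ ⟨z, rfl⟩
  rw [Env.parity, Env.lift_ι]
  exact ⟨_, rfl⟩

/-- The commutator with an even `y` is a derivation that maps generators to generators, so it
replaces one letter of a word by another. -/
theorem Env.even_commutator_mem {y : g} (hy : y ∈ even k g) {d : ℕ} {a : Env k g}
    (ha : a ∈ Env.filt k g d) : Env.ι k g y * a - a * Env.ι k g y ∈ Env.filt k g d := by
  induction d generalizing a with
  | zero =>
    obtain ⟨c, rfl⟩ := mem_wordFilt_zero.1 ha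
    rw [Algebra.commutes, sub_self]
    exact Submodule.zero_mem _
  | succ d ih =>
    refine wordFilt_succ_le (Q := (Env.filt k g (d + 1)).comap
      (LinearMap.mulLeft k (Env.ι k g y) - LinearMap.mulRight k (Env.ι k g y)))
      (fun a ha => wordFilt_mono (Nat.le_succ d) (ih ha)) ?_ ha
    rintro _ ⟨z, rfl⟩ a ha
    have e : Env.ι k g y * (Env.ι k g z * a) - Env.ι k g z * a * Env.ι k g y =
        Env.ι k g (bracket (k := k) y z) * a +
          Env.ι k g z * (Env.ι k g y * a - a * Env.ι k g y) := by
      rw [← mul_assoc, Env.ι_even_mul hy]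
      noncomm_ring
    simp only [Submodule.mem_comap, LinearMap.sub_apply, LinearMap.mulLeft_apply,
      LinearMap.mulRight_apply]
    rw [e]
    exact Submodule.add_mem _ (Env.ι_mul_mem_filt _ ha) (Env.ι_mul_mem_filt _ (ih ha))

/-- As in the even case, with a superderivation: `parity` carries the signs from passing `y` over
the letters of the word. -/
theorem Env.odd_commutator_mem {y : g} (hy : y ∈ odd k g) {d : ℕ} {a : Env k g}
    (ha : a ∈ Env.filt k g d) :
    Env.ι k g y * a - Env.parity k g a * Env.ι k g y ∈ Env.filt k g d := by
  induction d generalizing a with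
  | zero =>
    obtain ⟨c, rfl⟩ := mem_wordFilt_zero.1 ha
    rw [AlgHom.commutes, Algebra.commutes, sub_self]
    exact Submodule.zero_mem _
  | succ d ih =>
    refine wordFilt_succ_le (Q := (Env.filt k g (d + 1)).comap
      (LinearMap.mulLeft k (Env.ι k g y) -
        LinearMap.mulRight k (Env.ι k g y) ∘ₗ (Env.parity k g).toLinearMap))
      (fun a ha => wordFilt_mono (Nat.le_succ d) (ih ha)) ?_ ha
    rintro _ ⟨z, rfl⟩ a ha
    have e : Env.ι k g y * (Env.ι k g z * a) - Env.parity k g (Env.ι k g z * a) * Env.ι k g y =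
        Env.ι k g (bracket (k := k) y z) * a +
          Env.parity k g (Env.ι k g z) *
            (Env.ι k g y * a - Env.parity k g a * Env.ι k g y) := by
      rw [← mul_assoc, Env.ι_odd_mul hy, map_mul]
      noncomm_ring
    simp only [Submodule.mem_comap, LinearMap.sub_apply, LinearMap.mulLeft_apply,
      LinearMap.mulRight_apply, LinearMap.comp_apply, AlgHom.toLinearMap_apply]
    rw [e, add_comm d]
    exact Submodule.add_mem _ (mul_mem_wordFilt (Env.ι_mem_filt _) ha)
      (mul_mem_wordFilt (Env.parity_mem_filt (Env.ι_mem_filt _)) (ih ha))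

end EnvFiltration

/-! ### Odd monomials and straightening -/

section OddMonomials

variable {k g : Type*} [Field k] [AddCommGroup g] [Module k g] [LieSuperalgebra k g]
variable {ι : Type*} [LinearOrder ι] (b : Module.Basis ι k (odd k g))

/-- The product of the odd basis elements with index in `S`, in increasing order. -/
noncomputable def oddMonomial (S : Finset ι) : Env k g :=
  ((S.sort (· ≤ ·)).map fun i => Env.ι k g (b i)).prod

theorem oddMonomial_empty : oddMonomial b ∅ = 1 := by simp [oddMonomial]

variable {b}

theorem oddMonomial_insert {i : ι} {T : Finset ι} (h : ∀ l ∈ T, i < l) :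
    oddMonomial b (insert i T) = Env.ι k g (b i) * oddMonomial b T := by
  rw [oddMonomial, Finset.sort_insert (r := (· ≤ ·)) (fun l hl => (h l hl).le)
    (notMem_of_forall_lt h), List.map_cons, List.prod_cons, oddMonomial]

theorem oddMonomial_mem_filt (S : Finset ι) : oddMonomial b S ∈ Env.filt k g S.card := by
  induction S using Finset.induction_on_min with
  | empty => rw [oddMonomial_empty]; exact one_mem_wordFilt _
  | insert i T h ih =>
    rw [oddMonomial_insert h, Finset.card_insert_of_notMem (notMem_of_forall_lt h)]
    exact Env.ι_mul_mem_filt _ ih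

/-- Sort `b j` into the monomial. Each transposition costs a sign and a bracket term of lower
degree; if `j` already occurs, the square `b_j b_j` collapses to half a bracket and the degree
drops. -/
theorem ι_mul_oddMonomial [CharZero k] (j : ι) (S : Finset ι) :
    (j ∈ S → Env.ι k g (b j) * oddMonomial b S ∈ Env.filt k g S.card) ∧
    (j ∉ S → ∃ c : k, Env.ι k g (b j) * oddMonomial b S - c • oddMonomial b (insert j S) ∈
      Env.filt k g S.card) := by
  induction S using Finset.induction_on_min with
  | empty =>
    refine ⟨by simp, fun _ => ⟨1, ?_⟩⟩
    rw [one_smul, oddMonomial_insert (by simp), sub_self]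
    exact Submodule.zero_mem _
  | insert i T h ih =>
    have hc := Finset.card_insert_of_notMem (notMem_of_forall_lt h)
    rw [hc]
    have hbr : Env.ι k g (bracket (k := k) (b j : g) (b i)) * oddMonomial b T ∈
        Env.filt k g (T.card + 1) := Env.ι_mul_mem_filt _ (oddMonomial_mem_filt T)
    rcases lt_trichotomy j i with hj | rfl | hj
    · have hj' : ∀ l ∈ insert i T, j < l := fun l hl => by
        rcases Finset.mem_insert.1 hl with rfl | hl
        exacts [hj, hj.trans (h l hl)]
      refine ⟨fun h => (notMem_of_forall_lt hj' h).elim, fun _ => ⟨1, ?_⟩⟩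
      rw [one_smul, oddMonomial_insert hj', sub_self]
      exact Submodule.zero_mem _
    · refine ⟨fun _ => ?_, by simp⟩
      have e := Env.ι_mul_ι (k := k) (b j).2 (b j).2
      rw [koszulSign_one_one] at e
      have e' : (2 : k) • (Env.ι k g (b j) * Env.ι k g (b j)) =
          Env.ι k g (bracket (k := k) (b j : g) (b j)) := by
        rw [two_smul]; nth_rewrite 1 [e]; module
      rw [oddMonomial_insert h, ← mul_assoc,
        ← Submodule.smul_mem_iff _ (two_ne_zero (α := k)), ← smul_mul_assoc, e']
      exact hbr
    · have e := Env.ι_mul_ι (k := k) (b j).2 (b i).2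
      rw [koszulSign_one_one, neg_smul, one_smul] at e
      have e' : Env.ι k g (b j) * oddMonomial b (insert i T) =
          -(Env.ι k g (b i) * (Env.ι k g (b j) * oddMonomial b T)) +
            Env.ι k g (bracket (k := k) (b j : g) (b i)) * oddMonomial b T := by
        rw [oddMonomial_insert h, ← mul_assoc, e]
        noncomm_ring
      rw [e']
      refine ⟨fun hj' => ?_, fun hj' => ?_⟩
      · refine Submodule.add_mem _ (Submodule.neg_mem _ (Env.ι_mul_mem_filt _ (ih.1 ?_))) hbr
        exact (Finset.mem_insert.1 hj').resolve_left hj.ne'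
      · obtain ⟨c, hc⟩ := ih.2 fun h' => hj' (Finset.mem_insert_of_mem h')
        refine ⟨-c, ?_⟩
        have hi : ∀ l ∈ insert j T, i < l := fun l hl => by
          rcases Finset.mem_insert.1 hl with rfl | hl
          exacts [hj, h l hl]
        have hm := Env.ι_mul_mem_filt (b i : g) hc
        rw [Finset.insert_comm, oddMonomial_insert hi]
        convert! Submodule.add_mem _ (Submodule.neg_mem _ hm) hbr using 1
        rw [mul_sub, mul_smul_comm]
        module

end OddMonomials

section CoeffFilt

variable {k g : Type*} [Field k] [CharZero k] [AddCommGroup g] [Module k g] [LieSuperalgebra k g]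
variable {ι : Type*}

variable (k g ι) in
/-- The coefficient vectors of total degree at most `d`. -/
noncomputable def coeffFilt (d : ℕ) :
    Submodule k (Finset ι → UniversalEnvelopingAlgebra k (even k g)) :=
  Submodule.pi Set.univ fun S => if S.card ≤ d then evenFilt k g (d - S.card) else ⊥

theorem coeffFilt_fg [Finite ι] [Module.Finite k g] (d : ℕ) : (coeffFilt k g ι d).FG := by
  refine Submodule.fg_pi fun S => ?_
  split_ifs
  · refine finite_wordFilt ?_ _
    rw [LinearMap.range_eq_map]
    exact Module.Finite.fg_top.map _
  · exact Submodule.fg_bot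

variable [DecidableEq ι]

theorem single_mem_coeffFilt {d q : ℕ} {S : Finset ι} (h : S.card + q ≤ d)
    {w : UniversalEnvelopingAlgebra k (even k g)} (hw : w ∈ evenFilt k g q) :
    Pi.single S w ∈ coeffFilt k g ι d := by
  intro T _
  dsimp only
  rcases eq_or_ne T S with rfl | hT
  · rw [if_pos (by omega), Pi.single_eq_same]
    exact wordFilt_mono (by omega) hw
  · rw [Pi.single_eq_of_ne hT]
    exact Submodule.zero_mem _

variable [Fintype ι]

theorem coeffFilt_le {d : ℕ}
    {Q : Submodule k (Finset ι → UniversalEnvelopingAlgebra k (even k g))}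
    (h : ∀ (S : Finset ι) (q : ℕ) (w : UniversalEnvelopingAlgebra k (even k g)), S.card + q = d →
      w ∈ evenFilt k g q → Pi.single S w ∈ Q) : coeffFilt k g ι d ≤ Q := by
  intro v hv
  rw [← Finset.univ_sum_single v]
  refine Q.sum_mem fun S _ => ?_
  have hS := hv S (Set.mem_univ _)
  dsimp only at hS
  split_ifs at hS with hc
  · exact h S _ _ (by omega) hS
  · rw [(Submodule.mem_bot k).1 hS, Pi.single_zero]
    exact Q.zero_mem

theorem coeffFilt_mono {d e : ℕ} (h : d ≤ e) : coeffFilt k g ι d ≤ coeffFilt k g ι e :=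
  coeffFilt_le fun _ _ _ hS hw => single_mem_coeffFilt (hS.trans_le h) hw

attribute [local instance] LieRing.ofAssociativeRing in
theorem exists_mem_coeffFilt (v : Finset ι → UniversalEnvelopingAlgebra k (even k g)) :
    ∃ d, v ∈ coeffFilt k g ι d := by
  have h (w : UniversalEnvelopingAlgebra k (even k g)) : ∃ q, w ∈ evenFilt k g q :=
    exists_mem_wordFilt (by simpa using! adjoin_range_evenι k g) w
  choose q hq using fun S => h (v S)
  refine ⟨Finset.univ.sup fun S => S.card + q S, ?_⟩
  rw [← Finset.univ_sum_single v]
  exact Submodule.sum_mem _ fun S _ => single_mem_coeffFilt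
    (Finset.le_sup (f := fun S => S.card + q S) (Finset.mem_univ S)) (hq S)

end CoeffFilt

/-! ### Odd monomials span `Ug` over `Ug₀` -/

section Spanning

variable {k g : Type*} [Field k] [CharZero k] [AddCommGroup g] [Module k g] [LieSuperalgebra k g]
variable {ι : Type*} [LinearOrder ι] [Fintype ι] (b : Module.Basis ι k (odd k g))

/-- The map `(w_S) ↦ ∑ b_S w_S`, which expresses `Ug` through odd monomials and `Ug₀`. -/
noncomputable def monomialSum :
    (Finset ι → UniversalEnvelopingAlgebra k (even k g)) →ₗ[k] Env k g :=
  ∑ S, LinearMap.mulLeft k (oddMonomial b S) ∘ₗ (evenIncl k g).toLinearMap ∘ₗ LinearMap.proj S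

theorem monomialSum_apply (v : Finset ι → UniversalEnvelopingAlgebra k (even k g)) :
    monomialSum b v = ∑ S, oddMonomial b S * evenIncl k g (v S) := by
  simp [monomialSum]

theorem monomialSum_single (S : Finset ι) (w : UniversalEnvelopingAlgebra k (even k g)) :
    monomialSum b (Pi.single S w) = oddMonomial b S * evenIncl k g w := by
  rw [monomialSum_apply, Finset.sum_eq_single S]
  · simp
  · intro T _ hT
    simp [hT]
  · simp

theorem evenIncl_mem_filt {d : ℕ} {w : UniversalEnvelopingAlgebra k (even k g)}
    (hw : w ∈ evenFilt k g d) : evenIncl k g w ∈ Env.filt k g d := by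
  refine map_wordFilt_le _ ?_ hw
  rintro _ ⟨x, rfl⟩
  exact ⟨x, (evenIncl_ι k g x).symm⟩

theorem monomialSum_mem_filt {d : ℕ}
    {v : Finset ι → UniversalEnvelopingAlgebra k (even k g)} (hv : v ∈ coeffFilt k g ι d) :
    monomialSum b v ∈ Env.filt k g d := by
  refine coeffFilt_le (Q := (Env.filt k g d).comap (monomialSum b)) (fun S q w hS hw => ?_) hv
  rw [Submodule.mem_comap, monomialSum_single, ← hS]
  exact mul_mem_wordFilt (oddMonomial_mem_filt S) (evenIncl_mem_filt hw)

/-- Multiply a sum of degree `d` by one more generator. Its even part passes through `b_S` into the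
coefficient, its odd part joins `b_S`, and the corrections have degree at most `d`, where the
induction hypothesis applies. -/
theorem filt_le_map_monomialSum (d : ℕ) :
    Env.filt k g d ≤ (coeffFilt k g ι d).map (monomialSum b) := by
  induction d with
  | zero =>
    intro a ha
    obtain ⟨c, rfl⟩ := mem_wordFilt_zero.1 ha
    refine ⟨Pi.single ∅ (algebraMap k _ c), single_mem_coeffFilt (q := 0) (by simp)
      (mem_wordFilt_zero.2 ⟨c, rfl⟩), ?_⟩
    simp [monomialSum_single, oddMonomial_empty]
  | succ d ih =>
    have ih' : Env.filt k g d ≤ (coeffFilt k g ι (d + 1)).map (monomialSum b) :=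
      ih.trans (Submodule.map_mono (coeffFilt_mono (Nat.le_succ d)))
    have hsingle {S : Finset ι} {q : ℕ} (hS : S.card + q ≤ d + 1)
        {w : UniversalEnvelopingAlgebra k (even k g)} (hw : w ∈ evenFilt k g q) :
        oddMonomial b S * evenIncl k g w ∈ (coeffFilt k g ι (d + 1)).map (monomialSum b) :=
      ⟨Pi.single S w, single_mem_coeffFilt hS hw, monomialSum_single b S w⟩
    refine wordFilt_succ_le (fun a ha => ih' ha) ?_
    rintro _ ⟨x, rfl⟩ a ha
    obtain ⟨v, hv, rfl⟩ := ih ha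
    refine coeffFilt_le (Q := ((coeffFilt k g ι (d + 1)).map (monomialSum b)).comap
      (LinearMap.mulLeft k (Env.ι k g x) ∘ₗ monomialSum b)) (fun S q w hS hw => ?_) hv
    simp only [Submodule.mem_comap, LinearMap.comp_apply, monomialSum_single,
      LinearMap.mulLeft_apply]
    obtain ⟨x, hx, y, hy, rfl⟩ := exists_even_add_odd (k := k) x
    rw [map_add, add_mul]
    refine Submodule.add_mem _ ?_ ?_
    · have h1 : oddMonomial b S * evenIncl k g (UniversalEnvelopingAlgebra.ι k ⟨x, hx⟩ * w) ∈
          (coeffFilt k g ι (d + 1)).map (monomialSum b) :=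
        hsingle (q := 1 + q) (by omega) (mul_mem_wordFilt (mem_wordFilt_one ⟨⟨x, hx⟩, rfl⟩) hw)
      have h2 := mul_mem_wordFilt (Env.even_commutator_mem hx (oddMonomial_mem_filt (b := b) S))
        (evenIncl_mem_filt hw)
      rw [hS] at h2
      convert! Submodule.add_mem _ h1 (ih' h2) using 1
      rw [map_mul, evenIncl_ι]
      noncomm_ring
    · refine odd_mem_of_basis b (Q := ((coeffFilt k g ι (d + 1)).map (monomialSum b)).comap
        (LinearMap.mulRight k (oddMonomial b S * evenIncl k g w) ∘ₗ Env.ι k g)) (fun j => ?_) hy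
      simp only [Submodule.mem_comap, LinearMap.comp_apply, LinearMap.mulRight_apply]
      rw [← mul_assoc]
      by_cases hj : j ∈ S
      · have h := mul_mem_wordFilt ((ι_mul_oddMonomial (b := b) j S).1 hj) (evenIncl_mem_filt hw)
        rw [hS] at h
        exact ih' h
      · obtain ⟨c, hc⟩ := (ι_mul_oddMonomial (b := b) j S).2 hj
        have h := mul_mem_wordFilt hc (evenIncl_mem_filt hw)
        rw [hS] at h
        have h' := hsingle (S := insert j S) (by rw [Finset.card_insert_of_notMem hj]; omega) hw
        convert! Submodule.add_mem _ (ih' h) (Submodule.smul_mem _ c h') using 1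
        rw [sub_mul, smul_mul_assoc]
        abel

theorem monomialSum_surjective : Function.Surjective (monomialSum b) := fun a => by
  obtain ⟨d, hd⟩ := Env.exists_mem_filt a
  obtain ⟨v, _, hv⟩ := filt_le_map_monomialSum b d hd
  exact ⟨v, hv⟩

/-- `Ug` is also spanned by the products of elements of `Ug₀` with odd monomials. -/
theorem mem_span_even_mul_oddMonomial (a : Env k g) :
    a ∈ Submodule.span k {c | ∃ (w : UniversalEnvelopingAlgebra k (even k g)) (S : Finset ι),
      c = evenIncl k g w * oddMonomial b S} := by
  -- Commutators with `Ug₀` lose one degree. The bound `e` stands for `q + p - 1` without truncated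
  -- subtraction; if `e = 0`, one of the two factors is a scalar.
  have hcomm (q p e : ℕ) (h : q + p ≤ e + 1) (w : UniversalEnvelopingAlgebra k (even k g))
      (hw : w ∈ evenFilt k g q) (a : Env k g) (ha : a ∈ Env.filt k g p) :
      a * evenIncl k g w - evenIncl k g w * a ∈ Env.filt k g e := by
    induction q generalizing e w with
    | zero =>
      obtain ⟨c, rfl⟩ := mem_wordFilt_zero.1 hw
      rw [AlgHom.commutes, Algebra.commutes, sub_self]
      exact Submodule.zero_mem _
    | succ q ih =>
      rcases e with _ | e
      · obtain ⟨c, rfl⟩ := mem_wordFilt_zero.1 (wordFilt_mono (show p ≤ 0 by omega) ha)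
        rw [Algebra.commutes, sub_self]
        exact Submodule.zero_mem _
      refine wordFilt_succ_le (Q := (Env.filt k g (e + 1)).comap
        ((LinearMap.mulLeft k a - LinearMap.mulRight k a) ∘ₗ (evenIncl k g).toLinearMap))
        (fun w hw => ih (e + 1) (by omega) w hw) ?_ hw
      rintro _ ⟨x, rfl⟩ w hw
      have h1 := mul_mem_wordFilt (Env.even_commutator_mem x.2 ha) (evenIncl_mem_filt hw)
      have h2 := Env.ι_mul_mem_filt (x : g) (ih e (by omega) w hw)
      have h3 := Submodule.sub_mem _ h2 (wordFilt_mono (show p + q ≤ e + 1 by omega) h1)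
      rw [Submodule.mem_comap]
      convert! h3 using 1
      simp only [LinearMap.comp_apply, AlgHom.toLinearMap_apply, map_mul, LinearMap.sub_apply,
        LinearMap.mulLeft_apply, LinearMap.mulRight_apply, LieHom.coe_toLinearMap, evenIncl_ι]
      noncomm_ring
  obtain ⟨d, hd⟩ := Env.exists_mem_filt a
  induction d generalizing a with
  | zero =>
    obtain ⟨c, rfl⟩ := mem_wordFilt_zero.1 hd
    exact Submodule.subset_span ⟨algebraMap k _ c, ∅, by simp [oddMonomial_empty]⟩
  | succ d ih =>
    obtain ⟨v, hv, rfl⟩ := filt_le_map_monomialSum b _ hd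
    refine coeffFilt_le (Q := (Submodule.span k _).comap (monomialSum b))
      (fun S q w hS hw => ?_) hv
    rw [Submodule.mem_comap, monomialSum_single,
      ← sub_add_cancel (oddMonomial b S * evenIncl k g w) (evenIncl k g w * oddMonomial b S)]
    exact Submodule.add_mem _ (ih _ (hcomm q S.card d (by omega) w hw _ (oddMonomial_mem_filt S)))
      (Submodule.subset_span ⟨w, S, rfl⟩)

end Spanning


open scoped TensorProduct

/-! ### The relative Poincaré–Birkhoff–Witt theorem -/

section OddRep

variable {k g : Type*} [Field k] [CharZero k] [AddCommGroup g] [Module k g] [LieSuperalgebra k g]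
variable {ι : Type*} [LinearOrder ι] [Fintype ι] (b : Module.Basis ι k (odd k g))
variable {M : Type*} [AddCommGroup M] [Module k M]
variable (r : UniversalEnvelopingAlgebra k (even k g) →ₐ[k] Module.End k M)

attribute [local instance] LieRing.ofAssociativeRing

/-- The restriction of a representation of `Ug₀` to `g₀`. -/
noncomputable def evenRestrict : even k g →ₗ[k] Module.End k M :=
  r.toLinearMap ∘ₗ (UniversalEnvelopingAlgebra.ι k :
    even k g →ₗ⁅k⁆ UniversalEnvelopingAlgebra k (even k g)).toLinearMap

theorem evenRestrict_apply (x : even k g) :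
    evenRestrict r x = r (UniversalEnvelopingAlgebra.ι k x) := rfl

/-- The model of the induced module, on `Finset ι → M`. -/
noncomputable def oddRep : Env k g →ₐ[k] Module.End k (Finset ι → M) :=
  actRep b (ρ := evenRestrict r) fun x y => by
    simp only [evenRestrict_apply, LieHom.map_lie, LieRing.of_associative_ring_bracket, map_sub,
      map_mul]

variable {r}

theorem oddRep_ι (x : g) : oddRep b r (Env.ι k g x) = act b (evenRestrict r) x :=
  actRep_ι _ x

theorem oddRep_evenIncl (w : UniversalEnvelopingAlgebra k (even k g)) (m : M) :
    oddRep b r (evenIncl k g w) (Pi.single ∅ m) = Pi.single ∅ (r w m) := by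
  have hw : w ∈ Algebra.adjoin k
      (Set.range (UniversalEnvelopingAlgebra.ι k (L := even k g))) :=
    adjoin_range_evenι k g ▸ Algebra.mem_top
  induction hw using Algebra.adjoin_induction generalizing m with
  | mem w hw =>
    obtain ⟨x, rfl⟩ := hw
    rw [evenIncl_ι, oddRep_ι, act_even_empty, evenRestrict_apply]
  | algebraMap c => simp [Algebra.algebraMap_eq_smul_one, Pi.single_smul']
  | add w w' _ _ h h' =>
    simp only [map_add, LinearMap.add_apply, h, h', Pi.single_add]
  | mul w w' _ _ h h' => rw [map_mul, map_mul, map_mul, Module.End.mul_apply, h', h]; rfl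

theorem oddRep_oddMonomial (S : Finset ι) (m : M) :
    oddRep b r (oddMonomial b S) (Pi.single ∅ m) = Pi.single S m := by
  induction S using Finset.induction_on_min with
  | empty => simp [oddMonomial_empty]
  | insert i T h ih =>
    rw [oddMonomial_insert h, map_mul, Module.End.mul_apply, ih, oddRep_ι, act_odd_of_lt _ _ h]

theorem oddRep_monomialSum (v : Finset ι → UniversalEnvelopingAlgebra k (even k g)) (m : M) :
    oddRep b r (monomialSum b v) (Pi.single ∅ m) = fun S => r (v S) m := by
  rw [monomialSum_apply, map_sum, LinearMap.sum_apply,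
    ← Finset.univ_sum_single (fun S => r (v S) m)]
  refine Finset.sum_congr rfl fun S _ => ?_
  rw [map_mul, Module.End.mul_apply, oddRep_evenIncl, oddRep_oddMonomial]

/-- A relative Poincaré–Birkhoff–Witt theorem: the odd monomials are independent over `Ug₀`. -/
theorem monomialSum_injective : Function.Injective (monomialSum b) := by
  intro v v' h
  -- In the model for the left regular representation, applying the sum to `1` at `∅` returns its
  -- coefficients.
  have h' := congrArg (fun a => oddRep b
    (Algebra.lmul k (UniversalEnvelopingAlgebra k (even k g))) a (Pi.single ∅ 1)) h
  simpa [oddRep_monomialSum] using! h'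

end OddRep

/-! ### Induced modules and their model -/

section Induced

variable {k g : Type*} [Field k] [CharZero k] [AddCommGroup g] [Module k g] [LieSuperalgebra k g]
variable {M : Type*} [AddCommGroup M] [Module k M]
variable (r : UniversalEnvelopingAlgebra k (even k g) →ₐ[k] Module.End k M)

/-- `Ind.tmul` as a bilinear map. -/
noncomputable def Ind.mk : Env k g →ₗ[k] M →ₗ[k] Ind g r :=
  (TensorProduct.mk k (Env k g) M).compr₂ ((indRel g r).mkQ.restrictScalars k)

theorem Ind.mk_apply (a : Env k g) (m : M) : Ind.mk r a m = Ind.tmul r a m := rfl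

variable {r}

theorem Ind.tmul_mul_evenIncl (a : Env k g) (w : UniversalEnvelopingAlgebra k (even k g)) (m : M) :
    Ind.tmul r (a * evenIncl k g w) m = Ind.tmul r a (r w m) :=
  (Submodule.Quotient.eq _).2 (Submodule.subset_span ⟨a, w, m, rfl⟩)

theorem Ind.eq_top_of_tmul_mem {Q : Submodule k (Ind g r)} (h : ∀ a m, Ind.tmul r a m ∈ Q)
    (t : Ind g r) : t ∈ Q := by
  obtain ⟨t, rfl⟩ := (indRel g r).mkQ_surjective t
  induction t with
  | zero => rw [map_zero]; exact Q.zero_mem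
  | tmul a m => exact h a m
  | add t t' ht ht' => rw [map_add]; exact Q.add_mem ht ht'

variable {P : Type*} [AddCommGroup P] [Module k P] (R : Env k g →ₐ[k] Module.End k P)
  (f : M →ₗ[k] P)

/-- Frobenius reciprocity: `a ⊗ m ↦ a (f m)`. -/
noncomputable def Ind.lift (h : ∀ w m, R (evenIncl k g w) (f m) = f (r w m)) : Ind g r →ₗ[k] P :=
  ((indRel g r).restrictScalars k).liftQ
      (TensorProduct.lift (LinearMap.lcomp k P f ∘ₗ R.toLinearMap)) (by
    intro t ht
    rw [Submodule.restrictScalars_mem] at ht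
    rw [LinearMap.mem_ker]
    induction ht using Submodule.span_induction with
    | mem t ht =>
      obtain ⟨a, w, m, rfl⟩ := ht
      simp [h]
    | zero => exact map_zero _
    | add t t' _ _ ht ht' => rw [map_add, ht, ht', add_zero]
    | smul a t _ ht =>
      have ha (t) : TensorProduct.lift (LinearMap.lcomp k P f ∘ₗ R.toLinearMap) (a • t) =
          R a (TensorProduct.lift (LinearMap.lcomp k P f ∘ₗ R.toLinearMap) t) := by
        induction t with
        | zero => simp
        | tmul c m => simp [TensorProduct.smul_tmul']
        | add t t' ht ht' => rw [smul_add, map_add, map_add, map_add, ht, ht']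
      rw [ha, ht, map_zero]) ∘ₗ
    (Submodule.Quotient.restrictScalarsEquiv k (indRel g r)).symm.toLinearMap

variable {R f}

theorem Ind.map_smul_of_map_tmul {e : Ind g r →ₗ[k] P}
    (he : ∀ a m, e (Ind.tmul r a m) = R a (f m)) (a : Env k g) (t : Ind g r) :
    e (a • t) = R a (e t) := by
  refine Ind.eq_top_of_tmul_mem (Q := LinearMap.eqLocus
    (e ∘ₗ Module.toModuleEnd k (S := Env k g) (Ind g r) a) (R a ∘ₗ e)) (fun c m => ?_) t
  simp only [LinearMap.mem_eqLocus, LinearMap.comp_apply]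
  change e (Ind.tmul r (a * c) m) = _
  rw [he, he, map_mul, Module.End.mul_apply]

variable {ι : Type*} [LinearOrder ι] [Fintype ι] (b : Module.Basis ι k (odd k g))

variable (r) in
/-- The expression of the elements of the induced module through odd monomials. -/
noncomputable def Ind.ofFun : (Finset ι → M) →ₗ[k] Ind g r :=
  ∑ S, Ind.mk r (oddMonomial b S) ∘ₗ LinearMap.proj S

theorem Ind.ofFun_apply (v : Finset ι → M) :
    Ind.ofFun r b v = ∑ S, Ind.tmul r (oddMonomial b S) (v S) := by
  simp [Ind.ofFun, Ind.mk_apply]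

/-- Write `a` through odd monomials with coefficients in `Ug₀` on the right and move these
coefficients across the tensor sign. -/
theorem Ind.ofFun_surjective : Function.Surjective (Ind.ofFun r b) := by
  rw [← LinearMap.range_eq_top, eq_top_iff]
  intro t _
  refine Ind.eq_top_of_tmul_mem (fun a m => ?_) t
  obtain ⟨v, rfl⟩ := monomialSum_surjective b a
  refine ⟨fun S => r (v S) m, ?_⟩
  rw [Ind.ofFun_apply, monomialSum_apply, ← Ind.mk_apply, map_sum, LinearMap.sum_apply]
  exact Finset.sum_congr rfl fun S _ => (Ind.tmul_mul_evenIncl _ _ _).symm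

variable (r) in
/-- The isomorphism of the induced module with its model. -/
noncomputable def Ind.toFun : Ind g r →ₗ[k] (Finset ι → M) :=
  Ind.lift (oddRep b r) (LinearMap.single k (fun _ => M) ∅) (oddRep_evenIncl b)

theorem Ind.toFun_tmul (a : Env k g) (m : M) :
    Ind.toFun r b (Ind.tmul r a m) = oddRep b r a (Pi.single ∅ m) := rfl

theorem Ind.toFun_smul (a : Env k g) (t : Ind g r) :
    Ind.toFun r b (a • t) = oddRep b r a (Ind.toFun r b t) :=
  Ind.map_smul_of_map_tmul (f := LinearMap.single k (fun _ => M) ∅) (Ind.toFun_tmul b) a t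

theorem Ind.toFun_ofFun (v : Finset ι → M) : Ind.toFun r b (Ind.ofFun r b v) = v := by
  rw [Ind.ofFun_apply, map_sum]
  simp only [Ind.toFun_tmul, oddRep_oddMonomial]
  exact Finset.univ_sum_single v

theorem Ind.ofFun_injective : Function.Injective (Ind.ofFun r b) :=
  Function.LeftInverse.injective (Ind.toFun_ofFun b)

theorem Ind.toFun_injective : Function.Injective (Ind.toFun r b) := by
  intro t t' h
  obtain ⟨v, rfl⟩ := Ind.ofFun_surjective b t
  obtain ⟨v', rfl⟩ := Ind.ofFun_surjective b t'
  rw [Ind.toFun_ofFun, Ind.toFun_ofFun] at h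
  rw [h]

end Induced

/-! ### The grading of `Ug` -/

section Parity

variable {k g : Type*} [Field k] [AddCommGroup g] [Module k g] [LieSuperalgebra k g]

theorem Env.ι_mul_mem_part {i j : ZMod 2} {x : g} (hx : x ∈ LieSuperalgebra.part (k := k) i)
    {a : Env k g} (ha : a ∈ Env.part k g j) : Env.ι k g x * a ∈ Env.part k g (i + j) := by
  refine (Submodule.span_le (p := (Env.part k g (i + j)).comap
    (LinearMap.mulLeft k (Env.ι k g x)))).2 (fun c hc => ?_) ha
  exact Submodule.subset_span (Env.IsMonomial.mul hx hc)

theorem Env.one_mem_part : (1 : Env k g) ∈ Env.part k g 0 :=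
  Submodule.subset_span Env.IsMonomial.one

theorem Env.mul_mem_part {i j : ZMod 2} {a c : Env k g} (ha : a ∈ Env.part k g i)
    (hc : c ∈ Env.part k g j) : a * c ∈ Env.part k g (i + j) := by
  refine (Submodule.span_le (p := (Env.part k g (i + j)).comap
    (LinearMap.mulRight k c))).2 (fun a hm => ?_) ha
  clear ha
  change a * c ∈ Env.part k g (i + j)
  change Env.IsMonomial i a at hm
  induction hm with
  | one => simpa using hc
  | @mul i l x a hx hm ih =>
    rw [mul_assoc, add_assoc]
    exact Env.ι_mul_mem_part hx ih

theorem Env.ι_mem_part {i : ZMod 2} {x : g} (hx : x ∈ LieSuperalgebra.part (k := k) i) :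
    Env.ι k g x ∈ Env.part k g i := by
  simpa using! Env.ι_mul_mem_part hx Env.one_mem_part

theorem Env.exists_mem_part_add (a : Env k g) :
    ∃ a₀ ∈ Env.part k g 0, ∃ a₁ ∈ Env.part k g 1, a₀ + a₁ = a := by
  have ha : a ∈ Algebra.adjoin k (Set.range (Env.ι k g)) :=
    Env.adjoin_range_ι k g ▸ Algebra.mem_top
  induction ha using Algebra.adjoin_induction with
  | mem a ha =>
    obtain ⟨x, rfl⟩ := ha
    obtain ⟨x₀, h₀, x₁, h₁, rfl⟩ := exists_even_add_odd (k := k) x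
    exact ⟨_, Env.ι_mem_part h₀, _, Env.ι_mem_part h₁, (map_add _ _ _).symm⟩
  | algebraMap c =>
    rw [Algebra.algebraMap_eq_smul_one]
    exact ⟨_, Submodule.smul_mem _ c Env.one_mem_part, 0, Submodule.zero_mem _, add_zero _⟩
  | add a c _ _ ha hc =>
    obtain ⟨a₀, ha₀, a₁, ha₁, rfl⟩ := ha
    obtain ⟨c₀, hc₀, c₁, hc₁, rfl⟩ := hc
    exact ⟨_, Submodule.add_mem _ ha₀ hc₀, _, Submodule.add_mem _ ha₁ hc₁, by abel⟩
  | mul a c _ _ ha hc =>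
    obtain ⟨a₀, ha₀, a₁, ha₁, rfl⟩ := ha
    obtain ⟨c₀, hc₀, c₁, hc₁, rfl⟩ := hc
    have h₀₀ := Env.mul_mem_part ha₀ hc₀
    have h₁₁ := Env.mul_mem_part ha₁ hc₁
    have h₀₁ := Env.mul_mem_part ha₀ hc₁
    have h₁₀ := Env.mul_mem_part ha₁ hc₀
    rw [zero_add] at h₀₀ h₀₁
    rw [add_zero] at h₁₀
    rw [show (1 + 1 : ZMod 2) = 0 from rfl] at h₁₁
    exact ⟨_, Submodule.add_mem _ h₀₀ h₁₁, _, Submodule.add_mem _ h₀₁ h₁₀, by noncomm_ring⟩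

/-- The grading automorphism acts on `a` both by `1` and by `-1`, and `2` is invertible. -/
theorem Env.eq_zero_of_mem_part [CharZero k] {a : Env k g} (h₀ : a ∈ Env.part k g 0)
    (h₁ : a ∈ Env.part k g 1) : a = 0 := by
  have e₀ := Env.parity_of_mem h₀
  have e₁ := Env.parity_of_mem h₁
  rw [e₀, koszulSign_zero_right, koszulSign_one_one, one_smul, neg_smul, one_smul,
    eq_neg_iff_add_eq_zero, ← two_smul k, smul_eq_zero_iff_right two_ne_zero] at e₁
  exact e₁

theorem adTwistRep_mem_part (φ : Aut k g) {i j : ZMod 2} {a v : Env k g}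
    (ha : a ∈ Env.part k g i) (hv : v ∈ Env.part k g j) :
    adTwistRep φ a v ∈ Env.part k g (i + j) := by
  refine (Submodule.span_le (p := (Env.part k g (i + j)).comap
    ((adTwistRep φ).toLinearMap.flip v))).2 (fun a hm => ?_) ha
  clear ha
  change adTwistRep φ a v ∈ Env.part k g (i + j)
  change Env.IsMonomial i a at hm
  induction hm with
  | one => simpa using hv
  | @mul i l x a hx hm ih =>
    have h := ih
    rw [map_mul, Module.End.mul_apply, adTwistRep_ι, adTwist_apply φ hx h, add_assoc]
    refine Submodule.sub_mem _ (Env.ι_mul_mem_part hx h) (zsmul_mem ?_ _)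
    rw [add_comm i]
    exact Env.mul_mem_part h (Env.ι_mem_part (φ.map_part hx))

attribute [local instance] LieRing.ofAssociativeRing in
theorem evenIncl_mem_part [CharZero k] (w : UniversalEnvelopingAlgebra k (even k g)) :
    evenIncl k g w ∈ Env.part k g 0 := by
  have hw : w ∈ Algebra.adjoin k
      (Set.range (UniversalEnvelopingAlgebra.ι k (L := even k g))) :=
    adjoin_range_evenι k g ▸ Algebra.mem_top
  induction hw using Algebra.adjoin_induction with
  | mem w hw =>
    obtain ⟨x, rfl⟩ := hw
    rw [evenIncl_ι]
    exact Env.ι_mem_part x.2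
  | algebraMap c =>
    rw [AlgHom.commutes, Algebra.algebraMap_eq_smul_one]
    exact Submodule.smul_mem _ c Env.one_mem_part
  | add w w' _ _ h h' => rw [map_add]; exact Submodule.add_mem _ h h'
  | mul w w' _ _ h h' => rw [map_mul]; simpa using! Env.mul_mem_part h h'

end Parity

/-! ### The leading term of the twisted adjoint action -/

section TwistedLeadingTerm

variable {k g : Type*} [Field k] [AddCommGroup g] [Module k g] [LieSuperalgebra k g]
variable {φ : Aut k g}

/-- The leading term of the twisted adjoint action of an odd element. -/
theorem adTwist_odd_sub_mem {u : g} (hu : u ∈ odd k g) {d : ℕ} {a : Env k g}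
    (ha : a ∈ Env.filt k g d) :
    adTwist φ u a - Env.ι k g (u - φ u) * a ∈ Env.filt k g d := by
  -- The difference is exactly the supercommutator of `φ u` with `a`.
  have h := Env.odd_commutator_mem (φ.map_part hu) ha
  convert! h using 1
  rw [adTwist_odd φ hu, map_sub, sub_mul]
  change _ = Env.ι k g (φ u) * a - Env.parity k g a * Env.ι k g (φ u)
  abel

theorem adTwist_odd_mem {u : g} (hu : u ∈ odd k g) {d : ℕ} {a : Env k g}
    (ha : a ∈ Env.filt k g d) : adTwist φ u a ∈ Env.filt k g (d + 1) := by
  rw [← sub_add_cancel (adTwist φ u a) (Env.ι k g (u - φ u) * a)]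
  exact Submodule.add_mem _ (wordFilt_mono (Nat.le_succ d) (adTwist_odd_sub_mem hu ha))
    (Env.ι_mul_mem_filt _ ha)

/-- The elements `u - φ u` for `u` in a basis of `g₁` form a basis of `g₁`. -/
theorem exists_basis_sub {ι : Type*} [Module.Finite k g] (hfix : ∀ u : g, φ u = u → u ∈ even k g)
    (b : Module.Basis ι k (odd k g)) :
    ∃ b' : Module.Basis ι k (odd k g), ∀ i, (b' i : g) = b i - φ (b i) := by
  let f : odd k g →ₗ[k] odd k g := (LinearMap.id - φ.toLinearEquiv.toLinearMap).restrict
    fun u hu => Submodule.sub_mem _ hu (φ.map_part hu)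
  -- A fixed vector in `g₁` also lies in `g₀`, hence is zero; in finite dimension `f` is then
  -- bijective.
  have hf : Function.Injective f := by
    rw [injective_iff_map_eq_zero]
    intro u hu
    have h : (u : g) - φ u = 0 := congrArg Subtype.val hu
    have h' := hfix u (sub_eq_zero.1 h).symm
    exact Subtype.ext ((isCompl_part (k := k) (g := g)).disjoint.le_bot ⟨h', u.2⟩)
  exact ⟨b.map (LinearEquiv.ofInjectiveEndo f hf), fun i => by simp [f]⟩

variable {ι : Type*} [LinearOrder ι] {b b' : Module.Basis ι k (odd k g)}

/-- Each factor `b i` acts, up to lower degree, as left multiplication by `b i - φ (b i)`. The bound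
`e` plays the role of `S.card + q - 1`. -/
theorem adTwistRep_oddMonomial_sub_mem (hb : ∀ i, (b' i : g) = b i - φ (b i)) (S : Finset ι)
    {q e : ℕ} (h : S.card + q ≤ e + 1) {w : Env k g} (hw : w ∈ Env.filt k g q) :
    adTwistRep φ (oddMonomial b S) w - oddMonomial b' S * w ∈ Env.filt k g e := by
  induction S using Finset.induction_on_min generalizing e with
  | empty =>
    rw [oddMonomial_empty, oddMonomial_empty, map_one, one_mul, Module.End.one_apply, sub_self]
    exact Submodule.zero_mem _
  | insert i T hT ih =>
    rw [Finset.card_insert_of_notMem (notMem_of_forall_lt hT)] at h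
    have hmem : oddMonomial b' T * w ∈ Env.filt k g (T.card + q) :=
      mul_mem_wordFilt (oddMonomial_mem_filt T) hw
    have h1 := wordFilt_mono (show T.card + q ≤ e by omega)
      (adTwist_odd_sub_mem (φ := φ) (b i).2 hmem)
    rw [← hb] at h1
    have h2 : adTwist φ (b i) (adTwistRep φ (oddMonomial b T) w - oddMonomial b' T * w) ∈
        Env.filt k g e := by
      -- At `e = 0` the bound forces `T = ∅`, and the difference from the induction vanishes
      -- outright.
      rcases e with _ | e
      · have hT0 : T = ∅ := Finset.card_eq_zero.1 (by omega)
        subst hT0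
        simp [oddMonomial_empty]
      · exact adTwist_odd_mem (b i).2 (ih (by omega))
    convert! Submodule.add_mem _ h2 h1 using 1
    rw [oddMonomial_insert hT, oddMonomial_insert hT, map_mul, Module.End.mul_apply, adTwistRep_ι,
      map_sub, mul_assoc]
    abel

end TwistedLeadingTerm

/-! ### The twisted sum is bijective -/

section TwistedIso

variable {k g : Type*} [Field k] [CharZero k] [AddCommGroup g] [Module k g] [LieSuperalgebra k g]
variable (φ : Aut k g)

attribute [local instance] LieRing.ofAssociativeRing in
-- On `g₀` the twist is invisible, as `φ` is the identity there. This is the compatibility required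
-- by Frobenius reciprocity.
theorem adTwistRep_evenIncl (hφ : ∀ x ∈ even k g, φ x = x)
    (w v : UniversalEnvelopingAlgebra k (even k g)) :
    adTwistRep φ (evenIncl k g w) (evenIncl k g v) = evenIncl k g (evenAdRep k g w v) := by
  have hw : w ∈ Algebra.adjoin k
      (Set.range (UniversalEnvelopingAlgebra.ι k (L := even k g))) :=
    adjoin_range_evenι k g ▸ Algebra.mem_top
  induction hw using Algebra.adjoin_induction generalizing v with
  | mem w hw =>
    obtain ⟨x, rfl⟩ := hw
    rw [evenIncl_ι, adTwistRep_ι, adTwist_even φ x.2, hφ _ x.2, evenAdRep,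
      UniversalEnvelopingAlgebra.lift_ι_apply, LieHom.comp_apply, LieAlgebra.ad_apply,
      LieRing.of_associative_ring_bracket, map_sub, map_mul, map_mul, evenIncl_ι]
  | algebraMap c => simp [Algebra.algebraMap_eq_smul_one]
  | add w w' _ _ h h' => simp only [map_add, LinearMap.add_apply, h, h']
  | mul w w' _ _ h h' => rw [map_mul, map_mul, map_mul, Module.End.mul_apply, h', h]; rfl

variable {φ}

variable {ι : Type*} [LinearOrder ι] {b b' : Module.Basis ι k (odd k g)}

variable [Fintype ι] (φ b)

/-- The map `(w_S) ↦ ∑ ad_φ(b_S)(w_S)`. -/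
noncomputable def twistSum :
    (Finset ι → UniversalEnvelopingAlgebra k (even k g)) →ₗ[k] Env k g :=
  ∑ S, adTwistRep φ (oddMonomial b S) ∘ₗ (evenIncl k g).toLinearMap ∘ₗ LinearMap.proj S

theorem twistSum_apply (v : Finset ι → UniversalEnvelopingAlgebra k (even k g)) :
    twistSum φ b v = ∑ S, adTwistRep φ (oddMonomial b S) (evenIncl k g (v S)) := by
  simp [twistSum]

theorem twistSum_single (S : Finset ι) (w : UniversalEnvelopingAlgebra k (even k g)) :
    twistSum φ b (Pi.single S w) = adTwistRep φ (oddMonomial b S) (evenIncl k g w) := by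
  rw [twistSum_apply, Finset.sum_eq_single S]
  · simp
  · intro T _ hT
    simp [hT]
  · simp

variable {φ b}

theorem twistSum_sub_mem (hb : ∀ i, (b' i : g) = b i - φ (b i)) {d e : ℕ} (h : d ≤ e + 1)
    {v : Finset ι → UniversalEnvelopingAlgebra k (even k g)} (hv : v ∈ coeffFilt k g ι d) :
    twistSum φ b v - monomialSum b' v ∈ Env.filt k g e := by
  refine coeffFilt_le (Q := (Env.filt k g e).comap (twistSum φ b - monomialSum b'))
    (fun S q w hS hw => ?_) hv
  rw [Submodule.mem_comap, LinearMap.sub_apply, twistSum_single, monomialSum_single]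
  exact adTwistRep_oddMonomial_sub_mem hb S (by omega) (evenIncl_mem_filt hw)

theorem twistSum_mem (hb : ∀ i, (b' i : g) = b i - φ (b i)) {d : ℕ}
    {v : Finset ι → UniversalEnvelopingAlgebra k (even k g)} (hv : v ∈ coeffFilt k g ι d) :
    twistSum φ b v ∈ Env.filt k g d := by
  rw [← sub_add_cancel (twistSum φ b v) (monomialSum b' v)]
  exact Submodule.add_mem _ (twistSum_sub_mem hb (Nat.le_succ d) hv) (monomialSum_mem_filt b' hv)

/-- An element written as `∑ b'_S w_S` differs from the twisted sum with the same coefficients by an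
element of lower degree, which the induction covers. -/
theorem filt_le_map_twistSum (hb : ∀ i, (b' i : g) = b i - φ (b i)) (d : ℕ) :
    Env.filt k g d ≤ (coeffFilt k g ι d).map (twistSum φ b) := by
  induction d with
  | zero =>
    intro a ha
    obtain ⟨c, rfl⟩ := mem_wordFilt_zero.1 ha
    refine ⟨Pi.single ∅ (algebraMap k _ c), single_mem_coeffFilt (q := 0) (by simp)
      (mem_wordFilt_zero.2 ⟨c, rfl⟩), ?_⟩
    simp [twistSum_single, oddMonomial_empty]
  | succ d ih =>
    intro a ha
    obtain ⟨v, hv, rfl⟩ := filt_le_map_monomialSum b' _ ha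
    rw [← sub_sub_cancel (twistSum φ b v) (monomialSum b' v)]
    exact Submodule.sub_mem _ (Submodule.mem_map_of_mem hv)
      (Submodule.map_mono (coeffFilt_mono (Nat.le_succ d)) (ih (twistSum_sub_mem hb le_rfl hv)))

theorem twistSum_surjective (hb : ∀ i, (b' i : g) = b i - φ (b i)) :
    Function.Surjective (twistSum φ b) := fun a => by
  obtain ⟨d, hd⟩ := Env.exists_mem_filt a
  obtain ⟨v, _, hv⟩ := filt_le_map_twistSum hb d hd
  exact ⟨v, hv⟩

/-- In each degree the twisted sum is a surjection of finite-dimensional spaces. The bijection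
`monomialSum` between the same spaces shows that their dimensions agree, so the surjection is
injective. -/
theorem twistSum_injective [Module.Finite k g] (hb : ∀ i, (b' i : g) = b i - φ (b i)) :
    Function.Injective (twistSum φ b) := by
  rw [injective_iff_map_eq_zero]
  intro v hv
  obtain ⟨d, hd⟩ := exists_mem_coeffFilt v
  have : Module.Finite k (coeffFilt k g ι d) := Module.Finite.iff_fg.2 (coeffFilt_fg d)
  have : Module.Finite k (Env.filt k g d) := Module.Finite.iff_fg.2 (Env.filt_fg d)
  let f : coeffFilt k g ι d →ₗ[k] Env.filt k g d :=
    (monomialSum b).restrict fun _ h => monomialSum_mem_filt b h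
  let f' : coeffFilt k g ι d →ₗ[k] Env.filt k g d :=
    (twistSum φ b).restrict fun _ h => twistSum_mem hb h
  have hf : Function.Bijective f := by
    refine ⟨fun x y h => Subtype.ext (monomialSum_injective b (congrArg Subtype.val h)),
      fun a => ?_⟩
    obtain ⟨v, hv, h⟩ := filt_le_map_monomialSum b d a.2
    exact ⟨⟨v, hv⟩, Subtype.ext h⟩
  have hf' : Function.Surjective f' := fun a => by
    obtain ⟨v, hv, h⟩ := filt_le_map_twistSum hb d a.2
    exact ⟨⟨v, hv⟩, Subtype.ext h⟩
  have hinj := (LinearMap.injective_iff_surjective_of_finrank_eq_finrank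
    (LinearEquiv.ofBijective f hf).finrank_eq).2 hf'
  have h0 : f' ⟨v, hd⟩ = f' 0 := Subtype.ext (by simpa [f'] using hv)
  exact congrArg Subtype.val (hinj h0)

end TwistedIso

/-! ### The isomorphism with the induced module -/

section Main

variable {k g : Type*} [Field k] [CharZero k] [AddCommGroup g] [Module k g] [LieSuperalgebra k g]
variable {φ : Aut k g}

/-- The induced module of the adjoint representation of `g₀` is isomorphic to `Ug` with the twisted
adjoint action. -/
theorem exists_ind_equiv [Module.Finite k g] (hφ : ∀ x ∈ even k g, φ x = x)
    (hfix : ∀ u : g, φ u = u → u ∈ even k g) :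
    ∃ e : Ind g (evenAdRep k g) ≃ₗ[k] Env k g, ∀ a w,
      e (Ind.tmul (evenAdRep k g) a w) = adTwistRep φ a (evenIncl k g w) := by
  let b := Module.finBasis k (odd k g)
  obtain ⟨b', hb⟩ := exists_basis_sub hfix b
  let e : Ind g (evenAdRep k g) →ₗ[k] Env k g :=
    Ind.lift (adTwistRep φ) (evenIncl k g).toLinearMap (adTwistRep_evenIncl φ hφ)
  have he : e ∘ₗ Ind.ofFun (evenAdRep k g) b = twistSum φ b := by
    refine LinearMap.ext fun v => ?_
    rw [LinearMap.comp_apply, Ind.ofFun_apply, map_sum, twistSum_apply]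
    rfl
  have hbij : Function.Bijective (e ∘ Ind.ofFun (evenAdRep k g) b) := by
    rw [← LinearMap.coe_comp, he]
    exact ⟨twistSum_injective hb, twistSum_surjective hb⟩
  exact ⟨LinearEquiv.ofBijective e ((Function.Bijective.of_comp_iff e
    ⟨Ind.ofFun_injective b, Ind.ofFun_surjective b⟩).1 hbij), fun a w => rfl⟩

/-- The map sends each part into the part of the same degree. Equality follows because the two parts
span the source while those of `Ug` meet only in zero. -/
theorem map_ind_part {e : Ind g (evenAdRep k g) ≃ₗ[k] Env k g}
    (he : ∀ a w, e (Ind.tmul (evenAdRep k g) a w) = adTwistRep φ a (evenIncl k g w))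
    (i : ZMod 2) : (Ind.part (evenAdRep k g) i).map e.toLinearMap = Env.part k g i := by
  have hle (i : ZMod 2) : ∀ t ∈ Ind.part (evenAdRep k g) i, e t ∈ Env.part k g i := by
    intro t ht
    refine (Submodule.span_le (p := (Env.part k g i).comap e.toLinearMap)).2 ?_ ht
    rintro _ ⟨a, ha, w, rfl⟩
    change e (Ind.tmul _ a w) ∈ Env.part k g i
    rw [he]
    simpa using adTwistRep_mem_part φ ha (evenIncl_mem_part w)
  have htop (t : Ind g (evenAdRep k g)) :
      t ∈ Ind.part (evenAdRep k g) 0 ⊔ Ind.part (evenAdRep k g) 1 := by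
    refine Ind.eq_top_of_tmul_mem (fun a w => ?_) t
    obtain ⟨a₀, h₀, a₁, h₁, rfl⟩ := Env.exists_mem_part_add a
    rw [← Ind.mk_apply, map_add, LinearMap.add_apply]
    exact Submodule.add_mem_sup (Submodule.subset_span ⟨a₀, h₀, w, rfl⟩)
      (Submodule.subset_span ⟨a₁, h₁, w, rfl⟩)
  refine le_antisymm (Submodule.map_le_iff_le_comap.2 fun t ht => hle i t ht) fun a ha => ?_
  obtain ⟨t, rfl⟩ := e.surjective a
  refine Submodule.mem_map_of_mem ?_
  obtain ⟨t₀, h₀, t₁, h₁, rfl⟩ := Submodule.mem_sup.1 (htop t)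
  rw [map_add] at ha
  rcases zmod_two_cases i with rfl | rfl
  · have h := Env.eq_zero_of_mem_part
      ((Submodule.add_mem_iff_right _ (hle 0 _ h₀)).1 ha) (hle 1 _ h₁)
    rw [e.map_eq_zero_iff.1 h, add_zero]
    exact h₀
  · have h := Env.eq_zero_of_mem_part (hle 0 _ h₀)
      ((Submodule.add_mem_iff_left _ (hle 1 _ h₁)).1 ha)
    rw [e.map_eq_zero_iff.1 h, zero_add]
    exact h₁

end Main


/-! ### The top coefficient -/

section TopCoefficient

variable {k g : Type*} [Field k] [AddCommGroup g] [Module k g] [LieSuperalgebra k g]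
variable {ι : Type*} [LinearOrder ι] [Fintype ι] {b : Module.Basis ι k (odd k g)}
variable {M : Type*} [AddCommGroup M] [Module k M] {ρ : even k g →ₗ[k] Module.End k M}

/-- For sets of this size, only the term at `T` can reach `insert i T`, by the bounds on supports.
-/
theorem act_basis_apply_insert {i : ι} {T : Finset ι} (h : ∀ l ∈ T, i < l) {v : Finset ι → M}
    (hv : v ∈ supportedIn k M {S | S.card ≤ T.card}) : act b ρ (b i) v (insert i T) = v T := by
  have hi := notMem_of_forall_lt h
  have hc := Finset.card_insert_of_notMem hi
  refine eq_of_supportedIn (LinearMap.proj (insert i T) ∘ₗ act b ρ (b i)) (LinearMap.proj T)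
    (fun S hS m => ?_) hv
  have hS : S.card ≤ T.card := hS
  rw [LinearMap.comp_apply, LinearMap.proj_apply, LinearMap.proj_apply]
  rcases eq_or_ne S T with rfl | hST
  · rw [act_odd_of_lt b ρ h, Pi.single_eq_same, Pi.single_eq_same]
  · rw [Pi.single_eq_of_ne hST.symm]
    refine (act_bounds S).2 i m _ ?_
    rintro (hle | ⟨hiS, heq⟩)
    · omega
    · refine hST ?_
      rw [← Finset.erase_insert hiS, ← heq, Finset.erase_insert hi]

theorem act_odd_single_apply_insert {i : ι} {T : Finset ι} (h : ∀ l ∈ T, i < l) (y : odd k g)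
    (m : M) : act b ρ y (Pi.single T m) (insert i T) = b.repr y i • m := by
  have hi := notMem_of_forall_lt h
  have hc := Finset.card_insert_of_notMem hi
  have he : (LinearMap.proj (insert i T) ∘ₗ (act b ρ).flip (Pi.single T m)) ∘ₗ
      (odd k g).subtype = (b.coord i).smulRight m := by
    refine b.ext fun j => ?_
    simp only [LinearMap.comp_apply, LinearMap.flip_apply, LinearMap.proj_apply,
      Submodule.subtype_apply, LinearMap.smulRight_apply, Module.Basis.coord_apply,
      Module.Basis.repr_self]
    rcases eq_or_ne j i with rfl | hj
    · rw [act_odd_of_lt b ρ h, Pi.single_eq_same, Finsupp.single_eq_same, one_smul]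
    · rw [Finsupp.single_eq_of_ne hj.symm, zero_smul]
      refine (act_bounds T).2 j m _ ?_
      rintro (hle | ⟨_, heq⟩)
      · omega
      · have hi' : i ∈ insert j T := heq ▸ Finset.mem_insert_self i T
        exact (Finset.mem_insert.1 hi').elim (fun e => hj e.symm) hi
  exact LinearMap.congr_fun he y

/-- Moving `x` past `b i` adds the term with `[x, b i]` in place of `b i`; only its `b i`-component
returns to `S`. The diagonal entries of `ad x` therefore accumulate. -/
theorem act_even_single_apply_self (x : even k g) (S : Finset ι) (m : M) :
    act b ρ x (Pi.single S m) S = ρ x m + (∑ i ∈ S, b.repr (adOdd x (b i)) i) • m := by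
  induction S using Finset.induction_on_min with
  | empty => rw [act_even_empty, Pi.single_eq_same, Finset.sum_empty, zero_smul, add_zero]
  | insert i T h ih =>
    have hodd := act_odd_single_apply_insert (b := b) (ρ := ρ) h (adOdd x (b i)) m
    rw [act_even_insert h (act_bounds T).1, Pi.add_apply,
      act_basis_apply_insert h ((act_bounds T).1 x m), ih,
      Finset.sum_insert (notMem_of_forall_lt h), add_smul, add_assoc, add_comm (b.repr _ _ • m),
      ← hodd]
    rfl

/-- For the full set the accumulated diagonal entries are the trace of `ad x` on `g₁`, which
vanishes, so the top coefficient is `g₀`-equivariant. -/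
theorem act_even_apply_univ (hB : BerOddTrivial k g) (x : even k g) (v : Finset ι → M) :
    act b ρ x v Finset.univ = ρ x (v Finset.univ) := by
  have htr : ∑ i, b.repr (adOdd x (b i)) i = 0 := by
    have h := hB x
    rw [berOdd, neg_eq_zero, LinearMap.trace_eq_matrix_trace k b, Matrix.trace] at h
    simpa [LinearMap.toMatrix_apply] using h
  have he : LinearMap.proj Finset.univ ∘ₗ act b ρ x = ρ x ∘ₗ LinearMap.proj Finset.univ := by
    refine LinearMap.pi_ext fun S m => ?_
    simp only [LinearMap.comp_apply, LinearMap.proj_apply]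
    rcases eq_or_ne S Finset.univ with rfl | hS
    · rw [act_even_single_apply_self, htr, zero_smul, add_zero, Pi.single_eq_same]
    · rw [Pi.single_eq_of_ne hS.symm, map_zero]
      refine (act_bounds S).1 x m _ fun hle => hS ?_
      exact (Finset.card_eq_iff_eq_univ S).1 (le_antisymm (Finset.card_le_univ S) hle)
  exact LinearMap.congr_fun he v

/-- The constant is the sign from anticommuting `b j` into its place; what matters later is that it
is nonzero and independent of `m`. -/
theorem exists_act_basis_single_apply_insert (j : ι) (S : Finset ι) (hj : j ∉ S) :
    ∃ c : k, c ≠ 0 ∧ ∀ m : M, act b ρ (b j) (Pi.single S m) (insert j S) = c • m := by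
  induction S using Finset.induction_on_min with
  | empty =>
    refine ⟨1, one_ne_zero, fun m => ?_⟩
    rw [act_odd_of_lt b ρ (by simp), Pi.single_eq_same, one_smul]
  | insert i T h ih =>
    rcases lt_trichotomy j i with hji | rfl | hij
    · refine ⟨1, one_ne_zero, fun m => ?_⟩
      rw [act_odd_of_lt b ρ, Pi.single_eq_same, one_smul]
      intro l hl
      rcases Finset.mem_insert.1 hl with rfl | hl
      exacts [hji, hji.trans (h l hl)]
    · simp at hj
    · have hjT : j ∉ T := fun h' => hj (Finset.mem_insert_of_mem h')
      obtain ⟨c, hc, hcm⟩ := ih hjT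
      refine ⟨-c, neg_ne_zero.2 hc, fun m => ?_⟩
      have hi : ∀ l ∈ insert j T, i < l := fun l hl => by
        rcases Finset.mem_insert.1 hl with rfl | hl
        exacts [hij, h l hl]
      have hcard := Finset.card_insert_of_notMem hjT
      have hcard' := Finset.card_insert_of_notMem (notMem_of_forall_lt hi)
      have hb : bracket (k := k) (b j : g) (b i) ∈ even k g := by
        simpa using! bracket_mem (k := k) (b j).2 (b i).2
      have h0 : act b ρ (bracket (k := k) (b j : g) (b i)) (Pi.single T m)
          (insert i (insert j T)) = 0 :=
        (act_bounds T).1 ⟨_, hb⟩ m _ fun (hle : Finset.card _ ≤ _) => by omega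
      have hsupp : act b ρ (b j) (Pi.single T m) ∈
          supportedIn k M {S | S.card ≤ (insert j T).card} := by
        refine supportedIn_mono ?_ ((act_bounds T).2 j m)
        rintro S (hS | ⟨_, rfl⟩)
        · exact hS.trans (by omega)
        · exact le_refl (insert j T).card
      rw [act_odd_insert_of_lt h hij (act_bounds T).2, Finset.insert_comm, Pi.add_apply,
        Pi.neg_apply, act_basis_apply_insert hi hsupp, hcm, h0, add_zero, neg_smul]

theorem act_basis_apply_insert_of_card {j : ι} {S : Finset ι} (hj : j ∉ S) {v : Finset ι → M}
    (hv : v ∈ supportedIn k M {T | T.card ≤ S.card}) :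
    act b ρ (b j) v (insert j S) = act b ρ (b j) (Pi.single S (v S)) (insert j S) := by
  have hc := Finset.card_insert_of_notMem hj
  refine eq_of_supportedIn (LinearMap.proj (insert j S) ∘ₗ act b ρ (b j))
    (LinearMap.proj (insert j S) ∘ₗ act b ρ (b j) ∘ₗ LinearMap.single k (fun _ => M) S ∘ₗ
      LinearMap.proj S) (fun T hT m => ?_) hv
  have hT : T.card ≤ S.card := hT
  simp only [LinearMap.comp_apply, LinearMap.proj_apply, LinearMap.coe_single]
  rcases eq_or_ne T S with rfl | hTS
  · rw [Pi.single_eq_same]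
  · rw [Pi.single_eq_of_ne hTS.symm, Pi.single_zero, map_zero, Pi.zero_apply]
    refine (act_bounds T).2 j m _ ?_
    rintro (hle | ⟨hjT, heq⟩)
    · omega
    · refine hTS ?_
      rw [← Finset.erase_insert hjT, ← heq, Finset.erase_insert hj]

end TopCoefficient

/-! ### Nondegeneracy of the top coefficient, and invariants -/

section Invariants

variable {k g : Type*} [Field k] [CharZero k] [AddCommGroup g] [Module k g] [LieSuperalgebra k g]
variable {ι : Type*} [LinearOrder ι] [Fintype ι] {b : Module.Basis ι k (odd k g)}
variable {M : Type*} [AddCommGroup M] [Module k M]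
variable {r : UniversalEnvelopingAlgebra k (even k g) →ₐ[k] Module.End k M}

attribute [local instance] LieRing.ofAssociativeRing

/-- A vector of the induced module is `0` if the top coefficients of all its multiples vanish. -/
theorem eq_zero_of_oddRep_apply_univ {v : Finset ι → M}
    (h : ∀ a, oddRep b r a v Finset.univ = 0) : v = 0 := by
  -- If `S` has the largest size that the support of `v` allows, multiplying by the missing `b j`
  -- one at a time turns the coefficient at `S` into the top coefficient, up to a nonzero scalar.
  have key (n : ℕ) (v : Finset ι → M) (h : ∀ a, oddRep b r a v Finset.univ = 0) (S : Finset ι)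
      (hn : S.card + n = Fintype.card ι) (hv : v ∈ supportedIn k M {T | T.card ≤ S.card}) :
      v S = 0 := by
    induction n generalizing v S with
    | zero =>
      have hS : S = Finset.univ := (Finset.card_eq_iff_eq_univ S).1 (by omega)
      subst hS
      simpa using h 1
    | succ n ih =>
      obtain ⟨j, hj⟩ : ∃ j, j ∉ S := by
        by_contra! hall
        rw [Finset.eq_univ_of_forall hall, Finset.card_univ] at hn
        omega
      have hc := Finset.card_insert_of_notMem hj
      obtain ⟨c, hc0, hcm⟩ := exists_act_basis_single_apply_insert (b := b)
        (ρ := evenRestrict r) j S hj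
      have h0 := ih (act b (evenRestrict r) (b j) v)
        (fun a => by simpa [oddRep_ι] using h (a * Env.ι k g (b j)))
        (insert j S) (by omega) (by
          rw [hc]
          exact act_odd_mem (fun T _ => (act_bounds T).2) (b j).2 hv)
      rw [act_basis_apply_insert_of_card hj hv, hcm] at h0
      exact (smul_eq_zero.1 h0).resolve_left hc0
  -- Descending induction on the size of `S`, so that `key` always meets a vector with no larger
  -- sets in its support.
  have hdown (n : ℕ) : ∀ S : Finset ι, Fintype.card ι < S.card + n → v S = 0 := by
    induction n with
    | zero => exact fun S hS => absurd (Finset.card_le_univ S) (by omega)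
    | succ n ih =>
      intro S hS
      by_cases hS' : Fintype.card ι < S.card + n
      · exact ih S hS'
      · refine key n v h S (by omega) fun T hT => ih T ?_
        have hT : ¬ T.card ≤ S.card := hT
        omega
  funext S
  exact hdown (Fintype.card ι + 1) S (by omega)

/-- The space of invariants is determined by the top coefficient. -/
theorem eq_zero_of_invariant {v : Finset ι → M}
    (hv : ∀ u, oddRep b r (Env.ι k g u) v = 0) (h : v Finset.univ = 0) : v = 0 := by
  refine eq_zero_of_oddRep_apply_univ (b := b) (r := r) fun a => ?_
  have ha : a ∈ Algebra.adjoin k (Set.range (Env.ι k g)) :=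
    Env.adjoin_range_ι k g ▸ Algebra.mem_top
  have : ∃ c : k, oddRep b r a v = c • v := by
    induction ha using Algebra.adjoin_induction with
    | mem a ha =>
      obtain ⟨u, rfl⟩ := ha
      exact ⟨0, by rw [hv, zero_smul]⟩
    | algebraMap c => exact ⟨c, by simp [Algebra.algebraMap_eq_smul_one]⟩
    | add a a' _ _ h h' =>
      obtain ⟨c, hc⟩ := h
      obtain ⟨c', hc'⟩ := h'
      exact ⟨c + c', by rw [map_add, LinearMap.add_apply, hc, hc', add_smul]⟩
    | mul a a' _ _ h h' =>
      obtain ⟨c, hc⟩ := h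
      obtain ⟨c', hc'⟩ := h'
      exact ⟨c' * c, by rw [map_mul, Module.End.mul_apply, hc', map_smul, hc, smul_smul]⟩
  obtain ⟨c, hc⟩ := this
  rw [hc, Pi.smul_apply, h, smul_zero]

theorem oddRep_evenIncl_apply_univ (hB : BerOddTrivial k g)
    (w : UniversalEnvelopingAlgebra k (even k g)) (v : Finset ι → M) :
    oddRep b r (evenIncl k g w) v Finset.univ = r w (v Finset.univ) := by
  have hw : w ∈ Algebra.adjoin k
      (Set.range (UniversalEnvelopingAlgebra.ι k (L := even k g))) :=
    adjoin_range_evenι k g ▸ Algebra.mem_top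
  induction hw using Algebra.adjoin_induction generalizing v with
  | mem w hw =>
    obtain ⟨x, rfl⟩ := hw
    rw [evenIncl_ι, oddRep_ι, act_even_apply_univ hB, evenRestrict_apply]
  | algebraMap c => simp [Algebra.algebraMap_eq_smul_one]
  | add w w' _ _ h h' => simp only [map_add, LinearMap.add_apply, Pi.add_apply, h, h']
  | mul w w' _ _ h h' =>
    rw [map_mul, map_mul, Module.End.mul_apply, h, h', map_mul, Module.End.mul_apply]

variable (k g) in
/-- The augmentation of `Ug₀`. -/
noncomputable def evenAug : UniversalEnvelopingAlgebra k (even k g) →ₐ[k] k :=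
  UniversalEnvelopingAlgebra.lift k 0

variable (k g) in
/-- The trivial representation of `Ug₀`. -/
noncomputable def evenTriv : UniversalEnvelopingAlgebra k (even k g) →ₐ[k] Module.End k k :=
  (Algebra.ofId k (Module.End k k)).comp (evenAug k g)

theorem evenAug_ι (x : even k g) : evenAug k g (UniversalEnvelopingAlgebra.ι k x) = 0 :=
  UniversalEnvelopingAlgebra.lift_ι_apply k _ x

theorem evenTriv_apply (w : UniversalEnvelopingAlgebra k (even k g)) (c : k) :
    evenTriv k g w c = evenAug k g w • c := rfl

theorem apply_eq_evenAug_smul {m : M}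
    (hm : ∀ x : even k g, r (UniversalEnvelopingAlgebra.ι k x) m = 0)
    (w : UniversalEnvelopingAlgebra k (even k g)) : r w m = evenAug k g w • m := by
  have hw : w ∈ Algebra.adjoin k
      (Set.range (UniversalEnvelopingAlgebra.ι k (L := even k g))) :=
    adjoin_range_evenι k g ▸ Algebra.mem_top
  induction hw using Algebra.adjoin_induction with
  | mem w hw =>
    obtain ⟨x, rfl⟩ := hw
    rw [hm, evenAug_ι, zero_smul]
  | algebraMap c => simp [Algebra.algebraMap_eq_smul_one]
  | add w w' _ _ h h' => simp only [map_add, LinearMap.add_apply, h, h', add_smul]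
  | mul w w' _ _ h h' =>
    rw [map_mul, Module.End.mul_apply, h', map_smul, h, map_mul, smul_smul, mul_comm]

/-- An element of `M` killed by `g₀` gives a map from `Ug / Ug g₀` to the induced module. It is used
for the trivial module and for central elements of `Ug₀`. -/
theorem oddRep_eq_zero_of_mem_evenLeftIdeal {m : M}
    (hm : ∀ x : even k g, r (UniversalEnvelopingAlgebra.ι k x) m = 0) {a : Env k g}
    (ha : a ∈ evenLeftIdeal k g) : oddRep b r a (Pi.single ∅ m) = 0 := by
  induction ha using Submodule.span_induction with
  | mem a ha =>
    obtain ⟨x, hx, rfl⟩ := ha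
    lift x to even k g using hx
    rw [oddRep_ι, act_even_empty, evenRestrict_apply, hm, Pi.single_zero]
  | zero => rw [map_zero, LinearMap.zero_apply]
  | add a a' _ _ h h' => rw [map_add, LinearMap.add_apply, h, h', add_zero]
  | smul c a _ h => rw [smul_eq_mul, map_mul, Module.End.mul_apply, h, map_zero]

theorem evenIncl_sub_mem_evenLeftIdeal (w : UniversalEnvelopingAlgebra k (even k g)) :
    evenIncl k g w - algebraMap k _ (evenAug k g w) ∈ evenLeftIdeal k g := by
  have hw : w ∈ Algebra.adjoin k
      (Set.range (UniversalEnvelopingAlgebra.ι k (L := even k g))) :=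
    adjoin_range_evenι k g ▸ Algebra.mem_top
  induction hw using Algebra.adjoin_induction with
  | mem w hw =>
    obtain ⟨x, rfl⟩ := hw
    rw [evenIncl_ι, evenAug_ι, map_zero, sub_zero]
    exact Submodule.subset_span ⟨x, x.2, rfl⟩
  | algebraMap c => simp
  | add w w' _ _ h h' =>
    convert! Submodule.add_mem _ h h' using 1
    simp only [map_add]
    abel
  | mul w w' _ _ h h' =>
    convert! Submodule.add_mem _ (Submodule.smul_mem _ (evenIncl k g w) h')
      (Submodule.smul_mem _ (algebraMap k _ (evenAug k g w')) h) using 1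
    rw [smul_eq_mul, smul_eq_mul, map_mul, map_mul, map_mul, mul_sub, mul_sub,
      Algebra.commutes (evenAug k g w') (evenIncl k g w),
      Algebra.commutes (evenAug k g w') (algebraMap k _ (evenAug k g w))]
    abel

theorem oddRep_monomialSum_of_invariant {m : M}
    (hm : ∀ x : even k g, r (UniversalEnvelopingAlgebra.ι k x) m = 0)
    (w : Finset ι → UniversalEnvelopingAlgebra k (even k g)) :
    oddRep b r (monomialSum b w) (Pi.single ∅ m) = fun S => evenAug k g (w S) • m := by
  rw [oddRep_monomialSum]
  exact funext fun S => apply_eq_evenAug_smul hm (w S)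

theorem evenTriv_ι (x : even k g) (c : k) :
    evenTriv k g (UniversalEnvelopingAlgebra.ι k x) c = 0 := by
  rw [evenTriv_apply, evenAug_ι, zero_smul]

variable (b) in
/-- `Ug / Ug g₀` is the module induced from the trivial one. -/
theorem mem_evenLeftIdeal_iff {a : Env k g} :
    a ∈ evenLeftIdeal k g ↔ oddRep b (evenTriv k g) a (Pi.single ∅ 1) = 0 := by
  refine ⟨fun ha => oddRep_eq_zero_of_mem_evenLeftIdeal (fun x => evenTriv_ι x 1) ha, fun h => ?_⟩
  obtain ⟨w, rfl⟩ := monomialSum_surjective b a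
  rw [oddRep_monomialSum_of_invariant fun x => evenTriv_ι x 1] at h
  rw [monomialSum_apply]
  refine Submodule.sum_mem _ fun S _ => Submodule.smul_mem _ (oddMonomial b S) ?_
  have hS : evenAug k g (w S) = 0 := by simpa using congrFun h S
  simpa [hS] using evenIncl_sub_mem_evenLeftIdeal (w S)

variable (b) in
theorem mkQ_mem_ghostInvariants_iff {v : Env k g} :
    (evenLeftIdeal k g).mkQ v ∈ ghostInvariants k g ↔ ∀ u, oddRep b (evenTriv k g) (Env.ι k g u)
      (oddRep b (evenTriv k g) v (Pi.single ∅ 1)) = 0 := by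
  rw [mem_ghostInvariants]
  refine forall_congr' fun u => ?_
  rw [← map_smul, Submodule.mkQ_apply, Submodule.Quotient.mk_eq_zero, mem_evenLeftIdeal_iff b,
    smul_eq_mul, map_mul, Module.End.mul_apply]

variable (b) in
/-- The induced module of the trivial one has a nonzero invariant. -/
theorem exists_invariant (hB : BerOddTrivial k g) :
    ∃ t : Finset ι → k, t ≠ 0 ∧ ∀ u, oddRep b (evenTriv k g) (Env.ι k g u) t = 0 := by
  -- `L t` records the top coefficients of all `b_S t`. By equivariance these determine the top
  -- coefficient of `a t` for every `a`, once `a` is written with `Ug₀` on the left.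
  let L : (Finset ι → k) →ₗ[k] (Finset ι → k) := LinearMap.pi fun S =>
    LinearMap.proj Finset.univ ∘ₗ oddRep b (evenTriv k g) (oddMonomial b S)
  have hL (w : UniversalEnvelopingAlgebra k (even k g)) (S : Finset ι) (t : Finset ι → k) :
      oddRep b (evenTriv k g) (evenIncl k g w * oddMonomial b S) t Finset.univ =
        evenAug k g w * L t S := by
    rw [map_mul, Module.End.mul_apply, oddRep_evenIncl_apply_univ hB]
    rfl
  have hspan (t : Finset ι → k) (f : Env k g →ₗ[k] k)
      (hf : ∀ w S, f (evenIncl k g w * oddMonomial b S) = evenAug k g w * L t S) (a : Env k g) :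
      oddRep b (evenTriv k g) a t Finset.univ = f a := by
    refine (Submodule.span_le (p := LinearMap.eqLocus
      (LinearMap.proj Finset.univ ∘ₗ (oddRep b (evenTriv k g)).toLinearMap.flip t) f)).2 ?_
      (mem_span_even_mul_oddMonomial b a)
    rintro _ ⟨w, S, rfl⟩
    exact (hL w S t).trans (hf w S).symm
  have hinj : Function.Injective L := by
    rw [injective_iff_map_eq_zero]
    intro t ht
    exact eq_zero_of_oddRep_apply_univ fun a => hspan t 0 (by simp [ht]) a
  -- These are the values of the augmentation on the `b_S`, so the top coefficient of `a t` is the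
  -- augmentation of `a`. It vanishes on every `a u` with `u` in `g`, and nondegeneracy gives `u t =
  -- 0`.
  obtain ⟨t, ht⟩ := LinearMap.injective_iff_surjective.1 hinj (Pi.single ∅ 1)
  let aug : Env k g →ₐ[k] k := Env.lift 0 (by simp)
  have haug (x : g) : aug (Env.ι k g x) = 0 := Env.lift_ι _ _ x
  have haugw (w : UniversalEnvelopingAlgebra k (even k g)) : aug (evenIncl k g w) =
      evenAug k g w := by
    have h : aug.comp (evenIncl k g) = evenAug k g := by
      refine UniversalEnvelopingAlgebra.hom_ext k (LieHom.ext fun x => ?_)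
      change aug (evenIncl k g (UniversalEnvelopingAlgebra.ι k x)) =
        evenAug k g (UniversalEnvelopingAlgebra.ι k x)
      rw [evenIncl_ι, haug, evenAug_ι]
    exact DFunLike.congr_fun h w
  have haugS (S : Finset ι) : aug (oddMonomial b S) = (Pi.single ∅ 1 : Finset ι → k) S := by
    rcases S.eq_empty_or_nonempty with rfl | hn
    · rw [oddMonomial_empty, map_one, Pi.single_eq_same]
    · obtain ⟨i, T, h, rfl⟩ := exists_eq_insert hn
      rw [oddMonomial_insert h, map_mul, haug, zero_mul, Pi.single_eq_of_ne hn.ne_empty]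
  refine ⟨t, ?_, fun u => eq_zero_of_oddRep_apply_univ (b := b) (r := evenTriv k g) fun a => ?_⟩
  · rintro rfl
    have h := congrFun ht ∅
    simp at h
  · rw [← Module.End.mul_apply, ← map_mul, hspan t aug.toLinearMap
      (fun w S => by simp [haugw, haugS, ht])]
    simp [haug]

end Invariants

/-! ### Ghost invariants and the centre of `Ug₀` -/

section Ghost

variable {k g : Type*} [Field k] [CharZero k] [AddCommGroup g] [Module k g] [LieSuperalgebra k g]

theorem finrank_ghostInvariants [Module.Finite k g] (hB : BerOddTrivial k g) :
    Module.finrank k (ghostInvariants k g) = 1 := by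
  let b := Module.finBasis k (odd k g)
  obtain ⟨t, ht0, ht⟩ := exists_invariant b hB
  have htu : t Finset.univ ≠ 0 := fun h => ht0 (eq_zero_of_invariant ht h)
  let v := monomialSum b fun S => algebraMap k _ (t S)
  have hv : oddRep b (evenTriv k g) v (Pi.single ∅ 1) = t := by
    rw [oddRep_monomialSum_of_invariant (r := evenTriv k g) (m := 1) fun x => evenTriv_ι x 1]
    simp
  have hvi : (evenLeftIdeal k g).mkQ v ∈ ghostInvariants k g :=
    (mkQ_mem_ghostInvariants_iff b).2 (by rwa [hv])
  have hv0 : (⟨_, hvi⟩ : ghostInvariants k g) ≠ 0 := by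
    intro h
    have h' : (evenLeftIdeal k g).mkQ v = 0 := congrArg Subtype.val h
    rw [Submodule.mkQ_apply, Submodule.Quotient.mk_eq_zero, mem_evenLeftIdeal_iff b, hv] at h'
    exact ht0 h'
  refine (finrank_eq_one_iff_of_nonzero' _ hv0).2 fun ⟨q, hq⟩ => ?_
  obtain ⟨a, rfl⟩ := (evenLeftIdeal k g).mkQ_surjective q
  have ha := (mkQ_mem_ghostInvariants_iff b).1 hq
  set s := oddRep b (evenTriv k g) a (Pi.single ∅ 1)
  -- Invariants are determined by their top coefficients, so the scalar has to be the ratio of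
  -- these.
  refine ⟨s Finset.univ / t Finset.univ, Subtype.ext ?_⟩
  change (evenLeftIdeal k g).mkQ ((s Finset.univ / t Finset.univ) • v) =
    (evenLeftIdeal k g).mkQ a
  rw [Submodule.mkQ_apply, Submodule.mkQ_apply, Submodule.Quotient.eq, mem_evenLeftIdeal_iff b,
    map_sub, LinearMap.sub_apply, map_smul, LinearMap.smul_apply, hv]
  refine eq_zero_of_invariant (b := b) (r := evenTriv k g) (fun u => ?_) ?_
  · rw [map_sub, map_smul, ht, ha, smul_zero, sub_zero]
  · simp [s, htu]

attribute [local instance] LieRing.ofAssociativeRing in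
theorem mem_center_iff_evenAdRep {z : UniversalEnvelopingAlgebra k (even k g)} :
    z ∈ Subalgebra.center k (UniversalEnvelopingAlgebra k (even k g)) ↔
      ∀ x : even k g, evenAdRep k g (UniversalEnvelopingAlgebra.ι k x) z = 0 := by
  have he (x : even k g) : evenAdRep k g (UniversalEnvelopingAlgebra.ι k x) z =
      UniversalEnvelopingAlgebra.ι k x * z - z * UniversalEnvelopingAlgebra.ι k x := by
    rw [evenAdRep, UniversalEnvelopingAlgebra.lift_ι_apply, LieHom.comp_apply,
      LieAlgebra.ad_apply, LieRing.of_associative_ring_bracket]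
  rw [Subalgebra.mem_center_iff]
  refine ⟨fun h x => by rw [he, h, sub_self], fun h w => ?_⟩
  have hw : w ∈ Algebra.adjoin k
      (Set.range (UniversalEnvelopingAlgebra.ι k (L := even k g))) :=
    adjoin_range_evenι k g ▸ Algebra.mem_top
  induction hw using Algebra.adjoin_induction with
  | mem w hw =>
    obtain ⟨x, rfl⟩ := hw
    rw [← sub_eq_zero, ← he, h]
  | algebraMap c => exact Algebra.commutes _ _
  | add w w' _ _ h h' => rw [add_mul, mul_add, h, h']
  | mul w w' _ _ h h' => rw [mul_assoc, h', ← mul_assoc, h, mul_assoc]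

/-- In the model the map is `z ↦ v (1 ⊗ z)`, with top coefficient `c z`. Taking the top coefficient
embeds the invariants in the centre, so dividing it by `c` gives the inverse. -/
theorem exists_center_equiv [Module.Finite k g] {φ : Aut k g} (hφ : ∀ x ∈ even k g, φ x = x)
    (hfix : ∀ u : g, φ u = u → u ∈ even k g) (hB : BerOddTrivial k g) {v : Env k g}
    (hv : (evenLeftIdeal k g).mkQ v ∈ ghostInvariants k g) (hv0 : (evenLeftIdeal k g).mkQ v ≠ 0) :
    ∃ f : Subalgebra.center k (UniversalEnvelopingAlgebra k (even k g)) ≃ₗ[k] twistInvariants φ,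
      ∀ z, (f z : Env k g) = adTwistRep φ v (evenIncl k g z) := by
  let b := Module.finBasis k (odd k g)
  obtain ⟨e, he⟩ := exists_ind_equiv hφ hfix
  -- transport everything to the model of the induced module
  let E : Env k g →ₗ[k] (Finset _ → UniversalEnvelopingAlgebra k (even k g)) :=
    Ind.toFun (evenAdRep k g) b ∘ₗ e.symm.toLinearMap
  have hEinj : Function.Injective E := (Ind.toFun_injective b).comp e.symm.injective
  have hEmul (a c : Env k g) : E (adTwistRep φ a c) = oddRep b (evenAdRep k g) a (E c) := by
    obtain ⟨t, rfl⟩ := e.surjective c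
    have h := Ind.map_smul_of_map_tmul (e := e.toLinearMap) (f := (evenIncl k g).toLinearMap) he a t
    simp only [LinearEquiv.coe_coe] at h
    rw [← h]
    simp [E, Ind.toFun_smul]
  have hEone (w : UniversalEnvelopingAlgebra k (even k g)) :
      E (evenIncl k g w) = Pi.single ∅ w := by
    have h := he 1 w
    rw [map_one, Module.End.one_apply] at h
    rw [← h]
    simp [E, Ind.toFun_tmul]
  have hEinv (a : Env k g) : a ∈ twistInvariants φ ↔
      ∀ u, oddRep b (evenAdRep k g) (Env.ι k g u) (E a) = 0 := by
    rw [mem_twistInvariants]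
    refine forall_congr' fun u => ?_
    rw [← hEmul, adTwistRep_ι, map_eq_zero_iff E hEinj]
  obtain ⟨w, rfl⟩ := monomialSum_surjective b v
  have hvinv := (mem_ghostInvariants k g _).1 hv
  -- This scalar is the top coefficient of the class of `v` in `Ug / Ug g₀`, and a nonzero invariant
  -- has nonzero top coefficient.
  have hc : evenAug k g (w Finset.univ) ≠ 0 := by
    intro hc
    refine hv0 ?_
    rw [Submodule.mkQ_apply, Submodule.Quotient.mk_eq_zero, mem_evenLeftIdeal_iff b]
    refine eq_zero_of_invariant ((mkQ_mem_ghostInvariants_iff b).1 hv) ?_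
    rw [oddRep_monomialSum_of_invariant fun x => evenTriv_ι x 1]
    dsimp only
    rw [hc, zero_smul]
  set c := evenAug k g (w Finset.univ)
  have htop {z : UniversalEnvelopingAlgebra k (even k g)}
      (hz : z ∈ Subalgebra.center k (UniversalEnvelopingAlgebra k (even k g))) :
      E (adTwistRep φ (monomialSum b w) (evenIncl k g z)) Finset.univ = c • z := by
    rw [hEmul, hEone, oddRep_monomialSum_of_invariant (mem_center_iff_evenAdRep.1 hz)]
  have hinv (z : UniversalEnvelopingAlgebra k (even k g))
      (hz : z ∈ Subalgebra.center k (UniversalEnvelopingAlgebra k (even k g))) :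
      adTwistRep φ (monomialSum b w) (evenIncl k g z) ∈ twistInvariants φ := by
    rw [hEinv]
    intro u
    rw [hEmul, hEone, ← Module.End.mul_apply, ← map_mul]
    -- Invariance of the class of `v` means that `u v` lies in `Ug g₀`, which kills `1 ⊗ z` for
    -- central `z`.
    refine oddRep_eq_zero_of_mem_evenLeftIdeal (mem_center_iff_evenAdRep.1 hz) ?_
    have h := hvinv u
    rwa [← map_smul, Submodule.mkQ_apply, Submodule.Quotient.mk_eq_zero] at h
  let f : Subalgebra.center k (UniversalEnvelopingAlgebra k (even k g)) →ₗ[k]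
      twistInvariants φ :=
    LinearMap.codRestrict _ (adTwistRep φ (monomialSum b w) ∘ₗ (evenIncl k g).toLinearMap ∘ₗ
      (Subalgebra.center k _).val.toLinearMap) fun z => hinv z z.2
  refine ⟨LinearEquiv.ofBijective f ⟨?_, fun a => ?_⟩, fun z => rfl⟩
  · rw [injective_iff_map_eq_zero]
    intro z hz
    have h := htop z.2
    have hz' : adTwistRep φ (monomialSum b w) (evenIncl k g z) = 0 := congrArg Subtype.val hz
    rw [hz', map_zero, Pi.zero_apply, eq_comm, smul_eq_zero] at h
    exact Subtype.ext (h.resolve_left hc)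
  · have ha := (hEinv a).1 a.2
    -- Equivariance of the top coefficient makes that of an invariant `g₀`-invariant under the
    -- adjoint action, that is, central.
    have hz : c⁻¹ • E a Finset.univ ∈
        Subalgebra.center k (UniversalEnvelopingAlgebra k (even k g)) := by
      refine Subalgebra.smul_mem _ (mem_center_iff_evenAdRep.2 fun x => ?_) _
      rw [← oddRep_evenIncl_apply_univ (b := b) hB, evenIncl_ι, ha, Pi.zero_apply]
    refine ⟨⟨_, hz⟩, Subtype.ext (hEinj (sub_eq_zero.1 ?_))⟩
    have hf : (f ⟨_, hz⟩ : Env k g) =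
        adTwistRep φ (monomialSum b w) (evenIncl k g (c⁻¹ • E a Finset.univ)) := rfl
    refine eq_zero_of_invariant (b := b) (r := evenAdRep k g) (fun u => ?_) ?_
    · rw [map_sub, ha, (hEinv _).1 (f ⟨_, hz⟩).2, sub_zero]
    · rw [Pi.sub_apply, hf, htop hz, smul_inv_smul₀ hc, sub_self]

end Ghost

end LieSuperalgebra

theorem theorem1p6 {k g : Type*} [Field k] [CharZero k] [AddCommGroup g] [Module k g]
    [Module.Finite k g] [LieSuperalgebra k g] (φ : Aut k g)
    (hφ : ∀ x ∈ even k g, φ x = x) (hfix : ∀ u : g, φ u = u → u ∈ even k g) :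
    (∃ e : Ind g (evenAdRep k g) ≃ₗ[k] Env k g,
      (∀ (a : Env k g) (t : Ind g (evenAdRep k g)), e (a • t) = adTwistRep φ a (e t)) ∧
      (∀ i : ZMod 2, (Ind.part (evenAdRep k g) i).map e.toLinearMap = Env.part k g i) ∧
      (∀ w : UniversalEnvelopingAlgebra k (even k g),
        e (Ind.tmul (evenAdRep k g) 1 w) = evenIncl k g w)) ∧
    (BerOddTrivial k g →
      Module.finrank k (ghostInvariants k g) = 1 ∧
      ∀ v : Env k g, (evenLeftIdeal k g).mkQ v ∈ ghostInvariants k g →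
        (evenLeftIdeal k g).mkQ v ≠ 0 →
        ∃ f : Subalgebra.center k (UniversalEnvelopingAlgebra k (even k g)) ≃ₗ[k]
            twistInvariants φ,
          ∀ z, (f z : Env k g) = adTwistRep φ v (evenIncl k g z)) := by
  refine ⟨?_, fun hB => ⟨finrank_ghostInvariants hB, fun v hv hv0 =>
    exists_center_equiv hφ hfix hB hv hv0⟩⟩
  obtain ⟨e, he⟩ := exists_ind_equiv hφ hfix
  refine ⟨e, fun a t => ?_, map_ind_part he, fun w => ?_⟩
  · exact Ind.map_smul_of_map_tmul (e := e.toLinearMap) (f := (evenIncl k g).toLinearMap) he a t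
  · rw [he, map_one, Module.End.one_apply]
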